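/- Let $n\ge 2$ be an integer, $k>0$ and $\theta\in(0,\pi/2)$, and let $$\Sigma_\theta=\{(x,y)\in\mathbb{R}^{n-1}\times\mathbb{R} : y>-|x|\tan\theta\}.$$ If $w\in L^1(\Sigma_\theta)$ is a complex-valued function with $(\Delta+k^2)w=0$ in $\Sigma_\theta$ in the sense of distributions, then $w\equiv 0$ in $\Sigma_\theta$ (that is, $w=0$ almost everywhere in $\Sigma_\theta$). -/

import Mathlib

open MeasureTheory Set
open scoped ContDiff Laplacian

/-- The domain `Σ_θ = {(x, y) ∈ ℝⁿ⁻¹ × ℝ : y > -|x| tan θ}`, as a subset of `ℝⁿ⁻¹ × ℝ` with its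
Euclidean structure. It is used for `n ≥ 2` only. -/
def conicalDomain (n : ℕ) (θ : ℝ) : Set (WithLp 2 (EuclideanSpace ℝ (Fin (n - 1)) × ℝ)) :=
  {p | p.snd > -‖p.fst‖ * Real.tan θ}

/-- `(Δ + k²) w = 0` in the sense of distributions in `U`: for each real-valued
test function `φ ∈ C_c^∞(U)` one has `∫_U w (Δ φ + k² φ) = 0`. (Complex-valued test functions
give the same notion, by linearity.) It is used for `U` open and `w` integrable on `U`. -/
def IsWeakHelmholtzSolution {E : Type*} [NormedAddCommGroup E] [InnerProductSpace ℝ E]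
    [FiniteDimensional ℝ E] [MeasurableSpace E] [BorelSpace E]
    (k : ℝ) (U : Set E) (w : E → ℂ) : Prop :=
  ∀ φ : E → ℝ, ContDiff ℝ ∞ φ → HasCompactSupport φ → tsupport φ ⊆ U →
    ∫ p in U, ((Δ φ p + k ^ 2 * φ p : ℝ) : ℂ) * w p = 0

/-! The argument is a Fourier argument in half-spaces. Each point of the domain lies in a half-space
`⟪ν, p⟫ > 0` for which the domain contains a wider cone `⟪ν, p⟫ > -δ ‖p‖`, so it suffices to show `w
= 0` on such a half-space (`ae_eq_zero_of_halfSpace`). Fix a unit `τ ⟂ ν` and write `a = ⟪τ, p⟫`, `b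
= ⟪ν, p⟫`. Since `w` is integrable, test functions may be merely bounded with their derivatives
(`integral_bounded`). Take a cutoff supported in the wider cone times `e^{iξa} f(b)`, where `f'' +
(k² - ξ²) f = g` and `g` is supported in a slab above the transition region of the cutoff. This
gives `∫ e^{iξa} g(b) w` plus a commutator term. With `κ² = ξ² - k²` and `f` the bounded solution
equal to `c e^{κb}` below the slab, the commutator term is `c` times the flux of the wave with wave
vector `k (cos z, sin z)`, where `k cos z = ξ` and `i k sin z = κ`. For real `z` the wave is bounded
and testing with it shows that the flux is zero. For `ξ > k` the angle is `z = -it` and the wave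
grows with `b`; but the cutoff's derivatives live where `b ≤ ε (2 - |a|)`, so the flux is bounded
there, holomorphic in a half-strip below the real axis and continuous up to it. Vanishing on the
axis forces it to vanish below (`integral_fluxKernel_neg_imaginary`). Hence the Fourier transform of
`w` localised to a slab vanishes wherever the component of the frequency transverse to `ν` has
length other than `k`, and everywhere by continuity. Injectivity of the Fourier transform ends the
proof. -/

theorem two_le_infty : (2 : ℕ∞ω) ≤ ∞ :=
  WithTop.coe_le_coe.2 (le_top : (2 : ℕ∞) ≤ ⊤)

/-! ### Functions with bounded derivatives up to order two. -/

/-- Smooth functions which are bounded together with their derivatives of order one and two. -/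
structure HasBoundedC2 {F : Type*} [NormedAddCommGroup F] [NormedSpace ℝ F] (f : F → ℂ) : Prop where
  contDiff : ContDiff ℝ ∞ f
  bounded : ∀ i ≤ 2, ∃ C, ∀ x, ‖iteratedFDeriv ℝ i f x‖ ≤ C

namespace HasBoundedC2

section
variable {F G : Type*} [NormedAddCommGroup F] [NormedSpace ℝ F]
  [NormedAddCommGroup G] [NormedSpace ℝ G]

theorem of_compactSupport {f : F → ℂ} (hf : ContDiff ℝ ∞ f) (hc : HasCompactSupport f) :
    HasBoundedC2 f := by
  refine ⟨hf, fun i _ => ?_⟩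
  exact (hf.continuous_iteratedFDeriv (m := i) (mod_cast le_top)).bounded_above_of_compact_support
    (hc.iteratedFDeriv i)

theorem mul {f g : F → ℂ} (hf : HasBoundedC2 f) (hg : HasBoundedC2 g) :
    HasBoundedC2 (fun x => f x * g x) := by
  refine ⟨hf.contDiff.mul hg.contDiff, fun n hn => ?_⟩
  choose! A hA using hf.bounded
  choose! B hB using hg.bounded
  refine ⟨∑ i ∈ Finset.range (n + 1), (n.choose i : ℝ) * A i * B (n - i), fun x => ?_⟩
  refine (norm_iteratedFDeriv_mul_le hf.contDiff hg.contDiff x (n := n) (mod_cast le_top)).trans ?_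
  refine Finset.sum_le_sum fun i hi => ?_
  have hi' : i ≤ n := Nat.lt_succ_iff.mp (Finset.mem_range.mp hi)
  have h1 := hA i (hi'.trans hn) x
  have h2 := hB (n - i) ((Nat.sub_le n i).trans hn) x
  have := (norm_nonneg _).trans h1
  gcongr

theorem const_sub {f : F → ℂ} (hf : HasBoundedC2 f) (c : ℂ) :
    HasBoundedC2 (fun x => c - f x) := by
  refine ⟨contDiff_const.sub hf.contDiff, fun n hn => ?_⟩
  obtain ⟨A, hA⟩ := hf.bounded n hn
  refine ⟨‖c‖ + A, fun x => ?_⟩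
  have h : iteratedFDeriv ℝ n (fun x => c - f x) x
      = iteratedFDeriv ℝ n (fun _ : F => c) x - iteratedFDeriv ℝ n f x := by
    have := iteratedFDeriv_sub_apply (𝕜 := ℝ) (f := fun _ : F => c) (g := f) (i := n) (x := x)
      contDiff_const.contDiffAt (hf.contDiff.of_le (mod_cast le_top)).contDiffAt
    exact this
  rw [h]
  refine (norm_sub_le _ _).trans (add_le_add ?_ (hA x))
  rcases n with _ | n
  · simp
  · simp [iteratedFDeriv_succ_const]

theorem comp_clm {f : F → ℂ} (hf : HasBoundedC2 f) (L : G →L[ℝ] F) :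
    HasBoundedC2 (fun x => f (L x)) := by
  refine ⟨hf.contDiff.comp L.contDiff, fun n hn => ?_⟩
  obtain ⟨A, hA⟩ := hf.bounded n hn
  refine ⟨A * ∏ _i : Fin n, ‖L‖, fun x => ?_⟩
  have h := L.iteratedFDeriv_comp_right hf.contDiff x (i := n) (mod_cast le_top)
  have h' : iteratedFDeriv ℝ n (fun x => f (L x)) x = _ := h
  rw [h']
  refine (ContinuousMultilinearMap.norm_compContinuousLinearMap_le _ _).trans ?_
  gcongr
  exact hA _

theorem of_hasDerivAt {f f' f'' : ℝ → ℂ} (hf : ContDiff ℝ ∞ f)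
    (h1 : ∀ x, HasDerivAt f (f' x) x) (h2 : ∀ x, HasDerivAt f' (f'' x) x)
    (b0 : ∃ C, ∀ x, ‖f x‖ ≤ C) (b1 : ∃ C, ∀ x, ‖f' x‖ ≤ C) (b2 : ∃ C, ∀ x, ‖f'' x‖ ≤ C) :
    HasBoundedC2 f := by
  refine ⟨hf, fun n hn => ?_⟩
  have e1 : deriv f = f' := funext fun x => (h1 x).deriv
  have e2 : deriv f' = f'' := funext fun x => (h2 x).deriv
  simp only [norm_iteratedFDeriv_eq_norm_iteratedDeriv]
  interval_cases n
  · simpa using b0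
  · simpa [iteratedDeriv_one, e1] using b1
  · simpa [iteratedDeriv_succ, iteratedDeriv_zero, e1, e2] using b2

end

variable {E : Type*} [NormedAddCommGroup E] [InnerProductSpace ℝ E] [FiniteDimensional ℝ E]

theorem norm_laplacian_le {f : E → ℂ} {C : ℝ} {p : E} (h : ‖iteratedFDeriv ℝ 2 f p‖ ≤ C) :
    ‖Δ f p‖ ≤ Module.finrank ℝ E * C := by
  rw [InnerProductSpace.laplacian_eq_iteratedFDeriv_stdOrthonormalBasis]
  refine (norm_sum_le _ _).trans ?_
  refine (Finset.sum_le_card_nsmul _ _ C fun i _ => ?_).trans (by simp)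
  refine (ContinuousMultilinearMap.le_opNorm _ _).trans ?_
  simpa [Fin.prod_univ_two] using h

theorem exists_norm_laplacian_le {f : E → ℂ} (h : HasBoundedC2 f) : ∃ C, ∀ p, ‖Δ f p‖ ≤ C :=
  let ⟨C, hC⟩ := h.bounded 2 le_rfl
  ⟨Module.finrank ℝ E * C, fun p => norm_laplacian_le (hC p)⟩

end HasBoundedC2

theorem continuous_laplacian {E : Type*} [NormedAddCommGroup E] [InnerProductSpace ℝ E]
    [FiniteDimensional ℝ E] {f : E → ℂ} (hf : ContDiff ℝ ∞ f) : Continuous (Δ f) := by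
  rw [InnerProductSpace.laplacian_eq_iteratedFDeriv_stdOrthonormalBasis]
  refine continuous_finsetSum _ fun i _ => ?_
  have := hf.continuous_iteratedFDeriv (m := 2) two_le_infty
  fun_prop

/-! ### Enlarging the class of test functions. -/

section Weak

variable {E : Type*} [NormedAddCommGroup E] [InnerProductSpace ℝ E]
    [FiniteDimensional ℝ E] [MeasurableSpace E] [BorelSpace E]

theorem IsWeakHelmholtzSolution.integral_complex {k : ℝ} {U : Set E} {w : E → ℂ}
    (hsol : IsWeakHelmholtzSolution k U w) (hw : IntegrableOn w U)
    {φ : E → ℂ} (hφ : ContDiff ℝ ∞ φ) (hc : HasCompactSupport φ) (hU : tsupport φ ⊆ U) :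
    ∫ p in U, (Δ φ p + k ^ 2 * φ p) * w p = 0 := by
  have key : ∀ l : ℂ →L[ℝ] ℝ,
      Integrable (fun p => ((Δ (l ∘ φ) p + k ^ 2 * (l ∘ φ) p : ℝ) : ℂ) * w p)
        (volume.restrict U) ∧
      ∫ p in U, ((Δ (l ∘ φ) p + k ^ 2 * (l ∘ φ) p : ℝ) : ℂ) * w p = 0 := by
    intro l
    have hl : ContDiff ℝ ∞ (l ∘ φ) := l.contDiff.comp hφ
    have hlc : HasCompactSupport (l ∘ φ) := hc.comp_left (map_zero l)
    refine ⟨?_, hsol _ hl hlc ((closure_mono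
      (Function.support_comp_subset (map_zero l) φ)).trans hU)⟩
    have hΔ : ∀ p, Δ (l ∘ φ) p = l (Δ φ p) := fun p =>
      (hφ.contDiffAt.of_le two_le_infty).laplacian_CLM_comp_left
    obtain ⟨C, hC⟩ := (HasBoundedC2.of_compactSupport hφ hc).exists_norm_laplacian_le
    obtain ⟨D, hD⟩ := (HasBoundedC2.of_compactSupport hφ hc).bounded 0 (by norm_num)
    refine hw.bdd_mul (c := ‖l‖ * C + k ^ 2 * (‖l‖ * D)) ?_ (.of_forall fun p => ?_)
    · have := continuous_laplacian hφ
      have h2 := hφ.continuous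
      simp only [hΔ, Function.comp_apply]
      exact Continuous.aestronglyMeasurable (by fun_prop)
    · rw [Complex.norm_real, hΔ]
      refine (norm_add_le _ _).trans (add_le_add ?_ ?_)
      · exact (l.le_opNorm _).trans (by gcongr; exact hC p)
      · rw [norm_mul]
        have : ‖φ p‖ ≤ D := by simpa using hD p
        have h3 := (l.le_opNorm (φ p)).trans (mul_le_mul_of_nonneg_left this (norm_nonneg l))
        rw [Real.norm_of_nonneg (sq_nonneg k)]
        gcongr
        exact h3
  have hΔ : ∀ (l : ℂ →L[ℝ] ℝ) p, Δ (l ∘ φ) p = l (Δ φ p) := fun l p =>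
    (hφ.contDiffAt.of_le two_le_infty).laplacian_CLM_comp_left
  have h1 := key Complex.reCLM
  have h2 := key Complex.imCLM
  have h3 := integral_add h1.1 (h2.1.mul_const Complex.I)
  rw [integral_mul_const, h1.2, h2.2] at h3
  rw [zero_mul, zero_add] at h3
  rw [← h3]
  congr 1 with p
  rw [hΔ, hΔ]
  simp only [Function.comp_apply, Complex.reCLM_apply, Complex.imCLM_apply]
  conv_lhs => rw [← Complex.re_add_im (Δ φ p), ← Complex.re_add_im (φ p)]
  push_cast
  ring

/-- Truncate `φ` by the bumps `e (x / (R + 1))`. The bounds on the truncations and their Laplacians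
are uniform in `R`, so integrability of `w` allows dominated convergence. -/
theorem IsWeakHelmholtzSolution.integral_bounded {k : ℝ} {U : Set E} {w : E → ℂ}
    (hsol : IsWeakHelmholtzSolution k U w) (hw : IntegrableOn w U)
    {φ : E → ℂ} (hφ : HasBoundedC2 φ) (hU : tsupport φ ⊆ U) :
    ∫ p in U, (Δ φ p + k ^ 2 * φ p) * w p = 0 := by
  let η : ContDiffBump (0 : E) := ⟨1, 2, one_pos, one_lt_two⟩
  let e : E → ℂ := fun x => (η x : ℂ)
  have he : ContDiff ℝ ∞ e := Complex.ofRealCLM.contDiff.comp η.contDiff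
  have hec : HasCompactSupport e := η.hasCompactSupport.comp_left (g := fun x : ℝ => (x : ℂ)) (by simp)
  have heb := HasBoundedC2.of_compactSupport he hec
  let L : ℕ → E →L[ℝ] E := fun R => ((R + 1 : ℝ)⁻¹) • ContinuousLinearMap.id ℝ E
  have hL : ∀ R x, L R x = ((R + 1 : ℝ)⁻¹) • x := fun R x => rfl
  -- The dilations are contractions, so composing with them does not increase the bounds on the
  -- derivatives of `e`.
  have hLn : ∀ R, ‖L R‖ ≤ 1 := by
    intro R
    refine ContinuousLinearMap.opNorm_le_bound _ zero_le_one fun x => ?_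
    rw [hL, norm_smul, Real.norm_of_nonneg (by positivity)]
    gcongr
    exact inv_le_one_of_one_le₀ (by linarith [(Nat.cast_nonneg R : (0:ℝ) ≤ R)])
  let ψ : ℕ → E → ℂ := fun R x => e (L R x) * φ x
  have hψ : ∀ R, ContDiff ℝ ∞ (ψ R) := fun R => ((heb.comp_clm (L R)).mul hφ).contDiff
  have hψc : ∀ R, HasCompactSupport (ψ R) := by
    intro R
    refine HasCompactSupport.mul_right ?_
    let Φ : E ≃ₜ E := Homeomorph.smulOfNeZero ((R + 1 : ℝ)⁻¹) (by positivity)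
    exact hec.comp_homeomorph Φ
  have hψU : ∀ R, tsupport (ψ R) ⊆ U := fun R =>
    (closure_mono (Function.support_mul_subset_right _ _)).trans hU
  have hzero : ∀ R, ∫ p in U, (Δ (ψ R) p + k ^ 2 * ψ R p) * w p = 0 := fun R =>
    hsol.integral_complex hw (hψ R) (hψc R) (hψU R)
  choose! A hA using heb.bounded
  choose! B hB using hφ.bounded
  have hAe : ∀ R, ∀ i ≤ 2, ∀ x, ‖iteratedFDeriv ℝ i (fun x => e (L R x)) x‖ ≤ A i := by
    intro R i hi x
    have h := (L R).iteratedFDeriv_comp_right he x (i := i) (mod_cast le_top)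
    have h' : iteratedFDeriv ℝ i (fun x => e (L R x)) x = _ := h
    rw [h']
    refine (ContinuousMultilinearMap.norm_compContinuousLinearMap_le _ _).trans ?_
    have h1 : ∏ _j : Fin i, ‖L R‖ ≤ 1 := Finset.prod_le_one (fun _ _ => norm_nonneg _) fun _ _ => hLn R
    calc _ ≤ A i * 1 := by
          gcongr
          · exact (norm_nonneg _).trans (hA i hi x)
          · exact hA i hi _
      _ = A i := mul_one _
  have hbd : ∀ n ≤ 2, ∀ R x, ‖iteratedFDeriv ℝ n (ψ R) x‖
      ≤ ∑ i ∈ Finset.range (n + 1), (n.choose i : ℝ) * A i * B (n - i) := by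
    intro n hn R x
    refine (norm_iteratedFDeriv_mul_le (heb.comp_clm (L R)).contDiff hφ.contDiff x (n := n)
      (mod_cast le_top)).trans ?_
    refine Finset.sum_le_sum fun i hi => ?_
    have hi' : i ≤ n := Nat.lt_succ_iff.mp (Finset.mem_range.mp hi)
    have h1 := hAe R i (hi'.trans hn) x
    have h2 := hB (n - i) ((Nat.sub_le n i).trans hn) x
    have := (norm_nonneg _).trans h1
    gcongr
  obtain ⟨C0, hC0⟩ : ∃ C, ∀ R p, ‖ψ R p‖ ≤ C := ⟨_, fun R p => by simpa using hbd 0 (by norm_num) R p⟩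
  obtain ⟨C2, hC2⟩ : ∃ C, ∀ R p, ‖Δ (ψ R) p‖ ≤ C :=
    ⟨_, fun R p => HasBoundedC2.norm_laplacian_le (hbd 2 le_rfl R p)⟩
  have hlim : Filter.Tendsto (fun R => ∫ p in U, (Δ (ψ R) p + k ^ 2 * ψ R p) * w p) Filter.atTop
      (nhds (∫ p in U, (Δ φ p + k ^ 2 * φ p) * w p)) := by
    refine tendsto_integral_of_dominated_convergence (fun p => (C2 + k ^ 2 * C0) * ‖w p‖) ?_
      (hw.norm.const_mul _) ?_ ?_
    · intro R
      have h1 := continuous_laplacian (hψ R)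
      have h2 := (hψ R).continuous
      exact (Continuous.aestronglyMeasurable (by fun_prop)).mul hw.1
    · refine fun R => .of_forall fun p => ?_
      rw [norm_mul]
      gcongr
      refine (norm_add_le _ _).trans (add_le_add (hC2 R p) ?_)
      rw [norm_mul, norm_pow, Complex.norm_real, Real.norm_eq_abs, sq_abs]
      gcongr
      exact hC0 R p
    · refine .of_forall fun p => ?_
      refine tendsto_const_nhds.congr' ?_
      filter_upwards [Filter.eventually_ge_atTop ⌈‖p‖⌉₊] with R hR
      have hRp : ‖p‖ < R + 1 := (Nat.ceil_le.mp hR).trans_lt (lt_add_one _)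
      have hev : ψ R =ᶠ[nhds p] φ := by
        have : Metric.ball (0 : E) (R + 1) ∈ nhds p :=
          Metric.isOpen_ball.mem_nhds (by simpa using hRp)
        filter_upwards [this] with x hx
        have hx' : ‖x‖ < R + 1 := by simpa using hx
        have : η (L R x) = 1 := by
          refine η.one_of_mem_closedBall ?_
          rw [mem_closedBall_zero_iff, hL, norm_smul, Real.norm_of_nonneg (by positivity)]
          change _ ≤ (1 : ℝ)
          rw [inv_mul_le_iff₀ (by positivity)]
          linarith
        simp [ψ, e, this]
      rw [(InnerProductSpace.laplacian_congr_nhds hev).self_of_nhds, hev.self_of_nhds]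
  simp only [hzero] at hlim
  exact (tendsto_nhds_unique hlim tendsto_const_nhds)

end Weak

/-! ### Laplacian of a function of two orthonormal coordinates. -/

section Planar

variable {E : Type*} [NormedAddCommGroup E] [InnerProductSpace ℝ E]

theorem iteratedFDeriv_two_eq_of_hasDerivAt {φ : E → ℂ} (hφ : ContDiff ℝ 2 φ) (p v : E)
    {g : ℝ → ℂ} {g' : ℂ} (h1 : ∀ t : ℝ, HasDerivAt (fun t : ℝ => φ (p + t • v)) (g t) t)
    (h2 : HasDerivAt g g' 0) : iteratedFDeriv ℝ 2 φ p ![v, v] = g' := by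
  have hline : ∀ t : ℝ, HasDerivAt (fun t : ℝ => p + t • v) v t := fun t => by
    simpa using ((hasDerivAt_id t).smul_const v).const_add p
  have hd : Differentiable ℝ φ := hφ.differentiable (by norm_num)
  have hg : g = fun t => fderiv ℝ φ (p + t • v) v := by
    funext t
    exact (h1 t).unique ((hd _).hasFDerivAt.comp_hasDerivAt t (hline t))
  have hd2 : Differentiable ℝ (fderiv ℝ φ) :=
    (hφ.fderiv_right (m := 1) (by norm_num)).differentiable (by norm_num)
  have h3 : HasDerivAt g (fderiv ℝ (fderiv ℝ φ) p v v) 0 := by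
    rw [hg]
    have h4 : HasDerivAt (fun t : ℝ => fderiv ℝ φ (p + t • v)) (fderiv ℝ (fderiv ℝ φ) p v) 0 := by
      have h5 := (hd2 (p + (0 : ℝ) • v)).hasFDerivAt.comp_hasDerivAt (0 : ℝ) (hline 0)
      rwa [zero_smul, add_zero] at h5
    exact (ContinuousLinearMap.apply ℝ ℂ v).hasFDerivAt.comp_hasDerivAt (0 : ℝ) h4
  rw [iteratedFDeriv_two_apply]
  exact h3.unique h2

/-- Complete `τ, ν` to an orthonormal basis: the function is constant along every other basis
vector. -/
theorem laplacian_planar [FiniteDimensional ℝ E] {τ ν : E} (hτ : ‖τ‖ = 1) (hν : ‖ν‖ = 1)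
    (hτν : inner ℝ τ ν = 0) {Φ Φa Φb Φaa Φbb : ℝ → ℝ → ℂ}
    (ha : ∀ a b, HasDerivAt (fun a => Φ a b) (Φa a b) a)
    (haa : ∀ a b, HasDerivAt (fun a => Φa a b) (Φaa a b) a)
    (hb : ∀ a b, HasDerivAt (fun b => Φ a b) (Φb a b) b)
    (hbb : ∀ a b, HasDerivAt (fun b => Φb a b) (Φbb a b) b)
    (hφ : ContDiff ℝ 2 (fun p : E => Φ (inner ℝ τ p) (inner ℝ ν p))) (p : E) :
    Δ (fun p : E => Φ (inner ℝ τ p) (inner ℝ ν p)) p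
      = Φaa (inner ℝ τ p) (inner ℝ ν p) + Φbb (inner ℝ τ p) (inner ℝ ν p) := by
  classical
  have hne : τ ≠ ν := by
    rintro rfl
    rw [real_inner_self_eq_norm_sq, hτ] at hτν
    norm_num at hτν
  have hντ : inner ℝ ν τ = 0 := by rw [real_inner_comm, hτν]
  have hon : Orthonormal ℝ ((↑) : ({τ, ν} : Set E) → E) := by
    constructor
    · rintro ⟨x, rfl | rfl⟩ <;> assumption
    · rintro ⟨x, rfl | rfl⟩ ⟨y, rfl | rfl⟩ hxy <;> simp_all
  obtain ⟨u, B, hu, hB⟩ := hon.exists_orthonormalBasis_extension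
  rw [InnerProductSpace.laplacian_eq_iteratedFDeriv_orthonormalBasis _ B]
  set φ : E → ℂ := fun p : E => Φ (inner ℝ τ p) (inner ℝ ν p) with hφdef
  simp only [hB]
  rw [Finset.sum_coe_sort u (fun v => iteratedFDeriv ℝ 2 φ p ![v, v])]
  have hsub : ({τ, ν} : Finset E) ⊆ u := by
    intro x hx
    exact hu (by simpa using hx)
  rw [← Finset.sum_subset hsub, Finset.sum_pair hne]
  · congr 1
    · refine iteratedFDeriv_two_eq_of_hasDerivAt hφ p τ
        (g := fun t => Φa (inner ℝ τ p + t) (inner ℝ ν p)) (fun t => ?_) ?_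
      · have := (ha (inner ℝ τ p + t) (inner ℝ ν p)).comp_const_add (inner ℝ τ p) t
        simpa [hφdef, inner_add_right, inner_smul_right, hντ, real_inner_self_eq_norm_sq, hτ] using this
      · simpa using (haa (inner ℝ τ p + 0) (inner ℝ ν p)).comp_const_add (inner ℝ τ p) 0
    · refine iteratedFDeriv_two_eq_of_hasDerivAt hφ p ν
        (g := fun t => Φb (inner ℝ τ p) (inner ℝ ν p + t)) (fun t => ?_) ?_
      · have := (hb (inner ℝ τ p) (inner ℝ ν p + t)).comp_const_add (inner ℝ ν p) t
        simpa [hφdef, inner_add_right, inner_smul_right, hτν, real_inner_self_eq_norm_sq, hν] using this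
      · simpa using (hbb (inner ℝ τ p) (inner ℝ ν p + 0)).comp_const_add (inner ℝ ν p) 0
  · intro x hx hx'
    simp only [Finset.mem_insert, Finset.mem_singleton, not_or] at hx'
    have horth : ∀ y ∈ u, x ≠ y → inner ℝ y x = 0 := by
      intro y hy hxy
      have := B.orthonormal.2 (i := ⟨y, hy⟩) (j := ⟨x, hx⟩) (by simpa using Ne.symm hxy)
      simpa [hB] using this
    have h1 := horth τ (hsub (by simp)) hx'.1
    have h2 := horth ν (hsub (by simp)) hx'.2
    refine iteratedFDeriv_two_eq_of_hasDerivAt hφ p x (g := fun _ => 0) (fun t => ?_)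
      (hasDerivAt_const _ _)
    simpa [hφdef, inner_add_right, inner_smul_right, h1, h2] using hasDerivAt_const t (φ p)

end Planar

/-! ### Uniqueness from boundary values, and holomorphy of parameter integrals. -/

section ComplexAnalysis

open Complex

/-- A holomorphic function on a square, continuous up to the boundary and vanishing on the top
side, vanishes at the centre: the product of its four rotations vanishes on the boundary. -/
theorem eq_zero_of_eq_zero_on_top {f : ℂ → ℂ} {r : ℝ} (hr : 0 < r)
    (hf : DiffContOnCl ℂ f (Ioo (-r) r ×ℂ Ioo (-r) r))
    (h0 : ∀ x ∈ Icc (-r) r, f ⟨x, r⟩ = 0) : f 0 = 0 := by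
  set Q : Set ℂ := Ioo (-r) r ×ℂ Ioo (-r) r with hQ
  have hne : (-r) ≠ r := by linarith
  have hcl : closure Q = Icc (-r) r ×ℂ Icc (-r) r := by
    rw [hQ, closure_reProdIm, closure_Ioo hne]
  have hrot : ∀ c : ℂ, (∀ z ∈ Q, c * z ∈ Q) → DiffContOnCl ℂ (fun z => f (c * z)) Q := by
    intro c hc
    have : DiffContOnCl ℂ (fun z => c * z) Q :=
      (differentiable_id.const_mul c).diffContOnCl
    exact hf.comp this hc
  have hmem : ∀ z : ℂ, z ∈ Q ↔ (-r < z.re ∧ z.re < r) ∧ (-r < z.im ∧ z.im < r) := fun z => Iff.rfl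
  have d1 : DiffContOnCl ℂ (fun z => f (1 * z)) Q := hrot 1 (by simp)
  have d2 : DiffContOnCl ℂ (fun z => f (I * z)) Q := hrot I (by
    intro z hz; rw [hmem] at *; simp only [I_mul_re, I_mul_im]; grind)
  have d3 : DiffContOnCl ℂ (fun z => f ((-1) * z)) Q := hrot (-1) (by
    intro z hz; rw [hmem] at *; simp only [neg_mul, one_mul, neg_re, neg_im]; grind)
  have d4 : DiffContOnCl ℂ (fun z => f ((-I) * z)) Q := hrot (-I) (by
    intro z hz; rw [hmem] at *; simp only [neg_mul, neg_re, neg_im, I_mul_re, I_mul_im]; grind)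
  have hP := ((d1.smul d2).smul d3).smul d4
  have hbd : Bornology.IsBounded Q :=
    (Metric.isBounded_Ioo (-r) r).reProdIm (Metric.isBounded_Ioo (-r) r)
  have hopen : IsOpen Q := isOpen_Ioo.reProdIm isOpen_Ioo
  have hz : (0 : ℂ) ∈ Q := by rw [hmem]; simp [hr]
  have key := Complex.eqOn_of_eqOn_frontier hbd hP
    (diffContOnCl_const (c := (0 : ℂ))) ?_ hz
  · simpa using key
  · intro z hzf
    rw [hopen.frontier_eq, hcl] at hzf
    obtain ⟨⟨⟨h1, h2⟩, h3, h4⟩, h5⟩ := hzf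
    have h6 : z.re = r ∨ z.re = -r ∨ z.im = r ∨ z.im = -r := by
      rw [hmem] at h5
      grind
    simp only [smul_eq_mul, one_mul, neg_mul, mul_eq_zero]
    -- Each side of the square is carried to the top side by exactly one of the four rotations,
    -- which makes that factor vanish.
    rcases h6 with h | h | h | h
    · left; left; right
      convert h0 (-z.im) ⟨by linarith, by linarith⟩ using 2
      apply Complex.ext <;> simp [h]
    · right
      convert h0 (z.im) ⟨by linarith, by linarith⟩ using 2
      apply Complex.ext <;> simp [h]
    · left; left; left
      convert h0 (z.re) ⟨by linarith, by linarith⟩ using 2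
      apply Complex.ext <;> simp [h]
    · left; right
      convert h0 (-z.re) ⟨by linarith, by linarith⟩ using 2
      apply Complex.ext <;> simp [h]

/-- A point `c` close enough to the segment is the centre of a square whose top side lies in it, so
`f c = 0`. Such points form an open set, and the identity theorem spreads the vanishing over the
half-strip. -/
theorem eq_zero_of_eq_zero_on_real_segment {f : ℂ → ℂ} {d : ℝ} (hd : 0 < d)
    (hf : DifferentiableOn ℂ f (Ioo (-d) d ×ℂ Iio 0))
    (hc : ContinuousOn f (Ioo (-d) d ×ℂ Iic 0))
    (h0 : ∀ x ∈ Ioo (-d) d, f (x : ℂ) = 0) : EqOn f 0 (Ioo (-d) d ×ℂ Iio 0) := by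
  set S : Set ℂ := Ioo (-d) d ×ℂ Iio 0 with hS
  have hmem : ∀ z : ℂ, z ∈ S ↔ (-d < z.re ∧ z.re < d) ∧ z.im < 0 := fun z => Iff.rfl
  have hopen : IsOpen S := isOpen_Ioo.reProdIm isOpen_Iio
  have hnear : ∀ c : ℂ, c.im < 0 → |c.re| + |c.im| < d → f c = 0 := by
    intro c hc0 hcd
    have hr : 0 < -c.im := by linarith
    rw [abs_of_neg hc0] at hcd
    have hcd' := abs_lt.mp (show |c.re| < d + c.im by linarith)
    have key := eq_zero_of_eq_zero_on_top (f := fun z => f (c + z)) hr ⟨?_, ?_⟩ ?_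
    · simpa using key
    · refine hf.comp (differentiable_id.const_add c).differentiableOn ?_
      rintro z ⟨⟨h1, h2⟩, h3, h4⟩
      change (-d < (c + z).re ∧ (c + z).re < d) ∧ (c + z).im < 0
      rw [add_re, add_im]
      refine ⟨⟨?_, ?_⟩, ?_⟩ <;> linarith
    · refine hc.comp (continuous_const.add continuous_id).continuousOn ?_
      rw [closure_reProdIm, closure_Ioo (by linarith)]
      rintro z ⟨⟨h1, h2⟩, h3, h4⟩
      change (-d < (c + z).re ∧ (c + z).re < d) ∧ (c + z).im ≤ 0
      rw [add_re, add_im]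
      refine ⟨⟨?_, ?_⟩, ?_⟩ <;> linarith
    · intro x hx
      have h1 := h0 (c.re + x) ⟨by linarith [hx.1], by linarith [hx.2]⟩
      rw [← h1]
      congr 1
      apply Complex.ext <;> simp
  have hz0 : (⟨0, -(d / 2)⟩ : ℂ) ∈ S := by rw [hmem]; grind
  refine (hf.analyticOnNhd hopen).eqOn_zero_of_preconnected_of_eventuallyEq_zero ?_ hz0 ?_
  · exact (((convex_Ioo (-d) d).linear_preimage reLm).inter
      ((convex_Iio (0 : ℝ)).linear_preimage imLm)).isPreconnected
  · have h1 : ∀ᶠ c : ℂ in nhds ⟨0, -(d / 2)⟩, c.im < 0 :=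
      (continuous_im.tendsto _).eventually_lt_const (by simpa using hd)
    have h2 : ∀ᶠ c : ℂ in nhds ⟨0, -(d / 2)⟩, |c.re| + |c.im| < d := by
      have : Continuous fun c : ℂ => |c.re| + |c.im| := by fun_prop
      refine (this.tendsto _).eventually_lt_const ?_
      simp only [abs_zero, abs_neg, zero_add]
      rw [abs_of_pos (by positivity)]
      linarith
    filter_upwards [h1, h2] with c hc1 hc2 using hnear c hc1 hc2

/-- Cauchy's estimate on circles of radius `r / 2` turns a local bound on `F` into one on its
derivative, so no separate domination of the derivative is needed. -/
theorem differentiableOn_integral_of_dominated {α : Type*} [MeasurableSpace α] {μ : Measure α}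
    {S : Set ℂ} (hS : IsOpen S) {F : ℂ → α → ℂ}
    (hm : ∀ z ∈ S, AEStronglyMeasurable (F z) μ)
    (hd : ∀ p, DifferentiableOn ℂ (fun z => F z p) S)
    (hb : ∀ z₀ ∈ S, ∃ bound : α → ℝ, Integrable bound μ ∧
      ∀ᶠ z in nhds z₀, ∀ p, ‖F z p‖ ≤ bound p) :
    DifferentiableOn ℂ (fun z => ∫ p, F z p ∂μ) S := by
  intro z₀ hz₀
  obtain ⟨bound, hbi, hbd⟩ := hb z₀ hz₀
  obtain ⟨r, hr, hball⟩ := Metric.eventually_nhds_iff_ball.mp (hbd.and (hS.mem_nhds hz₀))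
  have hat : ∀ z ∈ Metric.ball z₀ r, ∀ p, HasDerivAt (fun z => F z p) (deriv (fun z => F z p) z) z :=
    fun z hz p => ((hd p).differentiableAt (hS.mem_nhds (hball z hz).2)).hasDerivAt
  refine (hasDerivAt_integral_of_dominated_loc_of_deriv_le (μ := μ) (F := F)
    (F' := fun z p => deriv (fun z => F z p) z) (bound := fun p => bound p / (r / 2))
    (Metric.ball_mem_nhds z₀ (half_pos hr)) ?_ ?_ ?_ ?_ (hbi.div_const _) ?_).2.differentiableAt.differentiableWithinAt
  · filter_upwards [hS.mem_nhds hz₀] with z hz using hm z hz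
  · exact hbi.mono' (hm z₀ hz₀) (.of_forall (hball z₀ (Metric.mem_ball_self hr)).1)
  -- Measurability of the derivative in `p`: it is a pointwise limit of difference quotients along a
  -- sequence.
  · let y : ℕ → ℂ := fun n => ((r / 2 / (n + 1) : ℝ) : ℂ)
    have hy0 : ∀ n, y n ≠ 0 := fun n => by
      simp only [y, ne_eq, ofReal_eq_zero]; positivity
    have hyr : ∀ n, z₀ + y n ∈ Metric.ball z₀ r := fun n => by
      have hn : (0 : ℝ) ≤ n := n.cast_nonneg
      simp only [y, Metric.mem_ball, dist_self_add_left, norm_real, Real.norm_eq_abs]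
      rw [abs_of_pos (by positivity), div_lt_iff₀ (by positivity)]
      nlinarith
    have hyt : Filter.Tendsto y Filter.atTop (nhds 0) := by
      have h1 : Filter.Tendsto (fun n : ℕ => r / 2 / ((n : ℝ) + 1)) Filter.atTop (nhds 0) :=
        tendsto_const_nhds.div_atTop
          (Filter.tendsto_atTop_add_const_right _ _ tendsto_natCast_atTop_atTop)
      have h2 := (continuous_ofReal.tendsto 0).comp h1
      rwa [ofReal_zero] at h2
    refine aestronglyMeasurable_of_tendsto_ae Filter.atTop
      (f := fun n p => (y n)⁻¹ • (F (z₀ + y n) p - F z₀ p)) (fun n => ?_) (.of_forall fun p => ?_)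
    · exact ((hm _ (hball _ (hyr n)).2).sub (hm z₀ hz₀)).const_smul ((y n)⁻¹)
    · have h1 := (hat z₀ (Metric.mem_ball_self hr) p).tendsto_slope_zero
      exact h1.comp (tendsto_nhdsWithin_iff.mpr ⟨hyt, .of_forall hy0⟩)
  · refine .of_forall fun p z hz => ?_
    have hsub : Metric.closedBall z (r / 2) ⊆ Metric.ball z₀ r := by
      intro x hx
      have h1 : dist x z ≤ r / 2 := hx
      have h2 : dist z z₀ < r / 2 := hz
      exact (dist_triangle x z z₀).trans_lt (by linarith)
    refine Complex.norm_deriv_le_of_forall_mem_sphere_norm_le (half_pos hr) ?_ ?_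
    · refine DifferentiableOn.diffContOnCl ?_
      rw [closure_ball _ (half_pos hr).ne']
      exact fun x hx => (hat x (hsub hx) p).differentiableAt.differentiableWithinAt
    · exact fun x hx => (hball x (hsub (Metric.sphere_subset_closedBall hx))).1 p
  · exact .of_forall fun p z hz => hat z (Metric.ball_subset_ball (by linarith) hz) p

end ComplexAnalysis

/-! ### The cutoff adapted to the cone and its explicit derivatives. -/

namespace SectorCutoff

/-- The smooth transition from `0` to `1`, as a complex-valued function. -/
noncomputable def step (x : ℝ) : ℂ := (Real.smoothTransition x : ℂ)

theorem contDiff_step : ContDiff ℝ ∞ step :=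
  Complex.ofRealCLM.contDiff.comp Real.smoothTransition.contDiff

theorem step_of_nonpos {x : ℝ} (h : x ≤ 0) : step x = 0 := by
  simp [step, Real.smoothTransition.zero_of_nonpos h]

theorem step_of_one_le {x : ℝ} (h : 1 ≤ x) : step x = 1 := by
  simp [step, Real.smoothTransition.one_of_one_le h]

theorem contDiff_deriv_step : ContDiff ℝ ∞ (deriv step) :=
  (contDiff_infty_iff_deriv.mp contDiff_step).2

theorem contDiff_deriv_deriv_step : ContDiff ℝ ∞ (deriv (deriv step)) :=
  (contDiff_infty_iff_deriv.mp contDiff_deriv_step).2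

theorem hasDerivAt_step (x : ℝ) : HasDerivAt step (deriv step x) x :=
  (contDiff_step.differentiable (by simp) x).hasDerivAt

theorem hasDerivAt_deriv_step (x : ℝ) : HasDerivAt (deriv step) (deriv (deriv step) x) x :=
  (contDiff_deriv_step.differentiable (by simp) x).hasDerivAt

theorem deriv_step_eq_zero {x : ℝ} (h : x < 0 ∨ 1 < x) : deriv step x = 0 := by
  rcases h with h | h
  · have : step =ᶠ[nhds x] fun _ => 0 := by
      filter_upwards [Iio_mem_nhds h] with y hy using step_of_nonpos (le_of_lt hy)
    simp [this.deriv_eq]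
  · have : step =ᶠ[nhds x] fun _ => 1 := by
      filter_upwards [Ioi_mem_nhds h] with y hy using step_of_one_le (le_of_lt hy)
    simp [this.deriv_eq]

theorem deriv_deriv_step_eq_zero {x : ℝ} (h : x < 0 ∨ 1 < x) : deriv (deriv step) x = 0 := by
  have : deriv step =ᶠ[nhds x] fun _ => 0 := by
    rcases h with h | h
    · filter_upwards [Iio_mem_nhds h] with y hy using deriv_step_eq_zero (.inl hy)
    · filter_upwards [Ioi_mem_nhds h] with y hy using deriv_step_eq_zero (.inr hy)
  simp [this.deriv_eq]

theorem norm_step_le (x : ℝ) : ‖step x‖ ≤ 1 := by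
  rw [step, Complex.norm_real, Real.norm_of_nonneg (Real.smoothTransition.nonneg x)]
  exact Real.smoothTransition.le_one x

theorem exists_norm_le_of_eq_zero {f : ℝ → ℂ} (hf : Continuous f)
    (h : ∀ x, x < 0 ∨ 1 < x → f x = 0) : ∃ C, ∀ x, ‖f x‖ ≤ C := by
  refine hf.bounded_above_of_compact_support (HasCompactSupport.intro (K := Icc 0 1) isCompact_Icc ?_)
  intro x hx
  refine h x ?_
  by_contra! h'
  exact hx h'

theorem hasBoundedC2_step_sub_one : HasBoundedC2 (fun x => step (x - 1)) := by
  obtain ⟨C1, h1⟩ := exists_norm_le_of_eq_zero contDiff_deriv_step.continuous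
    (fun _ => deriv_step_eq_zero)
  obtain ⟨C2, h2⟩ := exists_norm_le_of_eq_zero contDiff_deriv_deriv_step.continuous
    (fun _ => deriv_deriv_step_eq_zero)
  exact HasBoundedC2.of_hasDerivAt (contDiff_step.comp (contDiff_id.sub contDiff_const))
    (fun x => (hasDerivAt_step _).comp_sub_const x 1)
    (fun x => (hasDerivAt_deriv_step _).comp_sub_const x 1)
    ⟨1, fun x => norm_step_le _⟩ ⟨C1, fun x => h1 _⟩ ⟨C2, fun x => h2 _⟩

variable (ε a b : ℝ)

/-- A smooth function on the plane, which vanishes on `b ≤ ε (1 - |a|)` and is `1` on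
`b ≥ ε (2 - |a|)`. -/
noncomputable def fn : ℂ := 1 - (1 - step (b / ε + a - 1)) * (1 - step (b / ε - a - 1))

/-- The first derivative of the cutoff in `a`. -/
noncomputable def da : ℂ :=
  deriv step (b / ε + a - 1) * (1 - step (b / ε - a - 1))
    - (1 - step (b / ε + a - 1)) * deriv step (b / ε - a - 1)

/-- The second derivative of the cutoff in `a`. -/
noncomputable def daa : ℂ :=
  deriv (deriv step) (b / ε + a - 1) * (1 - step (b / ε - a - 1))
    + 2 * (deriv step (b / ε + a - 1) * deriv step (b / ε - a - 1))
    + (1 - step (b / ε + a - 1)) * deriv (deriv step) (b / ε - a - 1)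

/-- The first derivative of the cutoff in `b`. -/
noncomputable def db : ℂ :=
  (ε : ℂ)⁻¹ * (deriv step (b / ε + a - 1) * (1 - step (b / ε - a - 1))
    + (1 - step (b / ε + a - 1)) * deriv step (b / ε - a - 1))

/-- The second derivative of the cutoff in `b`. -/
noncomputable def dbb : ℂ :=
  (ε : ℂ)⁻¹ * ((ε : ℂ)⁻¹ * (deriv (deriv step) (b / ε + a - 1) * (1 - step (b / ε - a - 1))
    - 2 * (deriv step (b / ε + a - 1) * deriv step (b / ε - a - 1))
    + (1 - step (b / ε + a - 1)) * deriv (deriv step) (b / ε - a - 1)))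

theorem hasDerivAt_affine_a {f : ℝ → ℂ} {f' : ℂ} (h : HasDerivAt f f' (b / ε + a - 1)) :
    HasDerivAt (fun a => f (b / ε + a - 1)) f' a := by
  have h1 : HasDerivAt (fun a : ℝ => b / ε + a - 1) 1 a :=
    ((hasDerivAt_id a).const_add _).sub_const _
  exact (h.scomp a h1).congr_deriv (by simp)

theorem hasDerivAt_affine_neg_a {f : ℝ → ℂ} {f' : ℂ} (h : HasDerivAt f f' (b / ε - a - 1)) :
    HasDerivAt (fun a => f (b / ε - a - 1)) (-f') a := by
  have h1 : HasDerivAt (fun a : ℝ => b / ε - a - 1) (-1) a :=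
    ((hasDerivAt_id a).const_sub _).sub_const _
  exact (h.scomp a h1).congr_deriv (by simp)

theorem hasDerivAt_affine_b {f : ℝ → ℂ} {f' : ℂ} {c : ℝ} (h : HasDerivAt f f' (b / ε + c - 1)) :
    HasDerivAt (fun b => f (b / ε + c - 1)) ((ε : ℂ)⁻¹ * f') b := by
  have h1 : HasDerivAt (fun b : ℝ => b / ε + c - 1) (1 / ε) b :=
    (((hasDerivAt_id b).div_const ε).add_const _).sub_const _
  exact (h.scomp b h1).congr_deriv (by simp)

theorem hasDerivAt_affine_b' {f : ℝ → ℂ} {f' : ℂ} {c : ℝ} (h : HasDerivAt f f' (b / ε - c - 1)) :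
    HasDerivAt (fun b => f (b / ε - c - 1)) ((ε : ℂ)⁻¹ * f') b := by
  simp only [sub_eq_add_neg (_ / ε)] at h ⊢
  exact hasDerivAt_affine_b ε b h

theorem hasDerivAt_fn_a : HasDerivAt (fun a => fn ε a b) (da ε a b) a := by
  have h1 := (hasDerivAt_affine_a ε a b (hasDerivAt_step _)).const_sub 1
  have h2 := (hasDerivAt_affine_neg_a ε a b (hasDerivAt_step _)).const_sub 1
  exact ((h1.mul h2).const_sub 1).congr_deriv (by rw [da]; ring)

theorem hasDerivAt_da_a : HasDerivAt (fun a => da ε a b) (daa ε a b) a := by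
  have h1 := (hasDerivAt_affine_a ε a b (hasDerivAt_step _)).const_sub 1
  have h2 := (hasDerivAt_affine_neg_a ε a b (hasDerivAt_step _)).const_sub 1
  have h3 := hasDerivAt_affine_a ε a b (hasDerivAt_deriv_step _)
  have h4 := hasDerivAt_affine_neg_a ε a b (hasDerivAt_deriv_step _)
  exact ((h3.mul h2).sub (h1.mul h4)).congr_deriv (by rw [daa]; ring)

theorem hasDerivAt_fn_b : HasDerivAt (fun b => fn ε a b) (db ε a b) b := by
  have h1 := (hasDerivAt_affine_b ε b (c := a) (hasDerivAt_step _)).const_sub 1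
  have h2 := (hasDerivAt_affine_b' ε b (c := a) (hasDerivAt_step _)).const_sub 1
  exact ((h1.mul h2).const_sub 1).congr_deriv (by rw [db]; ring)

theorem hasDerivAt_db_b : HasDerivAt (fun b => db ε a b) (dbb ε a b) b := by
  have h1 := (hasDerivAt_affine_b ε b (c := a) (hasDerivAt_step _)).const_sub 1
  have h2 := (hasDerivAt_affine_b' ε b (c := a) (hasDerivAt_step _)).const_sub 1
  have h3 := hasDerivAt_affine_b ε b (c := a) (hasDerivAt_deriv_step _)
  have h4 := hasDerivAt_affine_b' ε b (c := a) (hasDerivAt_deriv_step _)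
  exact (((h3.mul h2).add (h1.mul h4)).const_mul _).congr_deriv (by rw [dbb]; ring)

variable {ε a b}

theorem fn_eq_one (h : 2 ≤ b / ε + |a|) : fn ε a b = 1 := by
  rcases abs_cases a with ⟨ha, _⟩ | ⟨ha, _⟩ <;> rw [ha] at h
  · simp [fn, step_of_one_le (x := b / ε + a - 1) (by linarith)]
  · simp [fn, step_of_one_le (x := b / ε - a - 1) (by linarith)]

theorem fn_eq_zero (h : b / ε + |a| ≤ 1) : fn ε a b = 0 := by
  have h1 := le_abs_self a
  have h2 := neg_abs_le a
  simp [fn, step_of_nonpos (x := b / ε + a - 1) (by linarith),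
    step_of_nonpos (x := b / ε - a - 1) (by linarith)]

/-- This confines the commutator to `b ≤ ε (2 - |a|)`, where waves growing with `b` stay bounded. -/
theorem deriv_eq_zero (h : 2 < b / ε + |a|) :
    da ε a b = 0 ∧ db ε a b = 0 ∧ daa ε a b = 0 ∧ dbb ε a b = 0 := by
  rcases abs_cases a with ⟨ha, _⟩ | ⟨ha, _⟩ <;> rw [ha] at h
  · have h1 : 1 < b / ε + a - 1 := by linarith
    simp [da, db, daa, dbb, step_of_one_le h1.le, deriv_step_eq_zero (.inr h1),
      deriv_deriv_step_eq_zero (.inr h1)]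
  · have h1 : 1 < b / ε - a - 1 := by linarith
    simp [da, db, daa, dbb, step_of_one_le h1.le, deriv_step_eq_zero (.inr h1),
      deriv_deriv_step_eq_zero (.inr h1)]

theorem exists_norm_deriv_le (ε : ℝ) : ∃ C, 0 ≤ C ∧ ∀ a b, ‖da ε a b‖ ≤ C ∧ ‖db ε a b‖ ≤ C ∧
    ‖daa ε a b‖ ≤ C ∧ ‖dbb ε a b‖ ≤ C := by
  obtain ⟨C1, h1⟩ := exists_norm_le_of_eq_zero contDiff_deriv_step.continuous
    (fun _ => deriv_step_eq_zero)
  obtain ⟨C2, h2⟩ := exists_norm_le_of_eq_zero contDiff_deriv_deriv_step.continuous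
    (fun _ => deriv_deriv_step_eq_zero)
  have p1 := (norm_nonneg _).trans (h1 0)
  have p2 := (norm_nonneg _).trans (h2 0)
  have h0 : ∀ x, ‖1 - step x‖ ≤ 2 := fun x =>
    (norm_sub_le _ _).trans (by rw [norm_one]; linarith [norm_step_le x])
  have first : ∀ x y, ‖deriv step x * (1 - step y)‖ ≤ C1 * 2 := fun x y => by
    rw [norm_mul]; exact mul_le_mul (h1 x) (h0 y) (norm_nonneg _) p1
  have first' : ∀ x y, ‖(1 - step x) * deriv step y‖ ≤ C1 * 2 := fun x y => by
    rw [mul_comm]; exact first y x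
  have second : ∀ x y, ‖deriv (deriv step) x * (1 - step y)‖ ≤ C2 * 2 := fun x y => by
    rw [norm_mul]; exact mul_le_mul (h2 x) (h0 y) (norm_nonneg _) p2
  have second' : ∀ x y, ‖(1 - step x) * deriv (deriv step) y‖ ≤ C2 * 2 := fun x y => by
    rw [mul_comm]; exact second y x
  have mixed : ∀ x y, ‖2 * (deriv step x * deriv step y)‖ ≤ 2 * (C1 * C1) := fun x y => by
    rw [norm_mul, norm_mul, Complex.norm_ofNat]
    gcongr
    · exact h1 x
    · exact h1 y
  set M1 := C1 * 2 + C1 * 2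
  set M2 := C2 * 2 + 2 * (C1 * C1) + C2 * 2
  set e := ‖(ε : ℂ)⁻¹‖
  have q1 : 0 ≤ M1 := by positivity
  have q2 : 0 ≤ M2 := by positivity
  have q3 : 0 ≤ e := norm_nonneg _
  have q4 : 0 ≤ e * M1 := by positivity
  have q5 : 0 ≤ e * (e * M2) := by positivity
  refine ⟨M1 + M2 + e * M1 + e * (e * M2), by positivity, fun a b => ⟨?_, ?_, ?_, ?_⟩⟩
  · refine ((norm_sub_le _ _).trans (add_le_add (first _ _) (first' _ _))).trans ?_
    linarith
  · have : ‖db ε a b‖ ≤ e * M1 := by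
      rw [db, norm_mul]
      exact mul_le_mul_of_nonneg_left
        ((norm_add_le _ _).trans (add_le_add (first _ _) (first' _ _))) q3
    linarith
  · refine ((norm_add₃_le).trans
      (add_le_add_three (second _ _) (mixed _ _) (second' _ _))).trans ?_
    linarith
  · have : ‖dbb ε a b‖ ≤ e * (e * M2) := by
      rw [dbb, norm_mul, norm_mul]
      refine mul_le_mul_of_nonneg_left (mul_le_mul_of_nonneg_left ?_ q3) q3
      refine (norm_add_le _ _).trans (add_le_add ?_ (second' _ _))
      exact (norm_sub_le _ _).trans (add_le_add (second _ _) (mixed _ _))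
    linarith

theorem continuous_deriv (ε : ℝ) : Continuous (fun q : ℝ × ℝ => da ε q.1 q.2) ∧
    Continuous (fun q : ℝ × ℝ => db ε q.1 q.2) ∧ Continuous (fun q : ℝ × ℝ => daa ε q.1 q.2) ∧
    Continuous (fun q : ℝ × ℝ => dbb ε q.1 q.2) := by
  have h0 := contDiff_step.continuous
  have h1 := contDiff_deriv_step.continuous
  have h2 := contDiff_deriv_deriv_step.continuous
  refine ⟨?_, ?_, ?_, ?_⟩ <;> simp only [da, db, daa, dbb] <;> fun_prop

theorem hasBoundedC2_fn {E : Type*} [NormedAddCommGroup E] [InnerProductSpace ℝ E] (τ ν : E) :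
    HasBoundedC2 (fun p => fn ε (inner ℝ τ p) (inner ℝ ν p)) := by
  have h1 := hasBoundedC2_step_sub_one.comp_clm (ε⁻¹ • innerSL ℝ ν + innerSL ℝ τ)
  have h2 := hasBoundedC2_step_sub_one.comp_clm (ε⁻¹ • innerSL ℝ ν - innerSL ℝ τ)
  have h3 := ((h1.const_sub 1).mul (h2.const_sub 1)).const_sub 1
  convert h3 using 2 with p
  simp [fn, div_eq_inv_mul]

end SectorCutoff

/-! ### Bounded solutions of the transverse equation. -/

section ODE

open Complex

theorem exists_norm_le_of_eventually_const {f : ℝ → ℂ} (hf : Continuous f) {β M : ℝ}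
    (h1 : ∀ x ≤ β, f x = f β) (h2 : ∀ x, M ≤ x → f x = f M) : ∃ C, 0 ≤ C ∧ ∀ x, ‖f x‖ ≤ C := by
  obtain ⟨C, hC⟩ := (isCompact_Icc (a := β) (b := M)).exists_bound_of_continuousOn hf.continuousOn
  refine ⟨|C| + ‖f β‖ + ‖f M‖, by positivity, fun x => ?_⟩
  have hb := norm_nonneg (f β)
  have hM := norm_nonneg (f M)
  have hC0 := abs_nonneg C
  rcases le_total x β with hx | hx
  · rw [h1 x hx]; linarith
  rcases le_total M x with hx' | hx'
  · rw [h2 x hx']; linarith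
  · have := hC x ⟨hx, hx'⟩
    linarith [le_abs_self C]

theorem hasDerivAt_exp_const_mul (κ : ℂ) (x : ℝ) :
    HasDerivAt (fun x : ℝ => exp (κ * x)) (κ * exp (κ * x)) x := by
  have h1 : HasDerivAt (fun x : ℝ => κ * (x : ℂ)) κ x := by
    simpa using (ofRealCLM.hasDerivAt (x := x)).const_mul κ
  simpa [mul_comm] using h1.cexp

theorem contDiff_exp_const_mul (κ : ℂ) : ContDiff ℝ ∞ (fun x : ℝ => exp (κ * x)) :=
  (contDiff_const.mul ofRealCLM.contDiff).cexp

/-- Variation of constants. Integrating against `e^{-κs}` from `M` and against `e^{κs}` from `β`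
removes the `e^{κx}` component above `M` and the `e^{-κx}` component below `β`, so `0 ≤ κ.re` makes
the solution bounded on both ends. -/
theorem exists_bounded_solution {κ : ℂ} (hκ : κ ≠ 0) (hre : 0 ≤ κ.re) {g : ℝ → ℂ}
    (hg : ContDiff ℝ ∞ g) {β M : ℝ} (hβ : 0 ≤ β) (h1 : ∀ x ≤ β, g x = 0) (h2 : ∀ x, M ≤ x → g x = 0) :
    ∃ (f f' : ℝ → ℂ) (c : ℂ), ContDiff ℝ ∞ f ∧ (∀ x, HasDerivAt f (f' x) x) ∧
      (∀ x, HasDerivAt f' (κ ^ 2 * f x + g x) x) ∧ (∃ C, ∀ x, ‖f x‖ ≤ C) ∧ (∃ C, ∀ x, ‖f' x‖ ≤ C) ∧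
      ∀ x ≤ β, f x = c * exp (κ * x) ∧ f' x = c * (κ * exp (κ * x)) := by
  have anti : ∀ (q : ℂ) (a : ℝ), ContDiff ℝ ∞ (fun b : ℝ => ∫ s in a..b, exp (q * s) * g s) ∧
      ∀ b : ℝ, HasDerivAt (fun b : ℝ => ∫ s in a..b, exp (q * s) * g s) (exp (q * b) * g b) b := by
    intro q a
    have hs : ContDiff ℝ ∞ (fun s : ℝ => exp (q * s) * g s) := (contDiff_exp_const_mul q).mul hg
    have hd : ∀ b : ℝ, HasDerivAt (fun b : ℝ => ∫ s in a..b, exp (q * s) * g s) (exp (q * b) * g b) b :=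
      fun b => (hs.continuous).integral_hasStrictDerivAt a b |>.hasDerivAt
    refine ⟨?_, hd⟩
    rw [contDiff_infty_iff_deriv]
    exact ⟨fun b => (hd b).differentiableAt, by rwa [funext fun b => (hd b).deriv]⟩
  obtain ⟨cP, dP⟩ := anti (-κ) M
  obtain ⟨cQ, dQ⟩ := anti κ β
  set P : ℝ → ℂ := fun b => ∫ s in M..b, exp (-κ * s) * g s with hP
  set Q : ℝ → ℂ := fun b => ∫ s in β..b, exp (κ * s) * g s with hQ
  have dconst : ∀ {F : ℝ → ℂ} {q : ℂ} {S : Set ℝ}, (∀ b : ℝ, HasDerivAt F (exp (q * b) * g b) b) →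
      Convex ℝ S → (∀ x ∈ S, g x = 0) → ∀ x ∈ S, ∀ y ∈ S, F x = F y := by
    intro F q S hF hS hgS x hx y hy
    refine hS.is_const_of_fderivWithin_eq_zero (𝕜 := ℝ)
      (fun z _ => (hF z).differentiableAt.differentiableWithinAt) ?_ hx hy
    intro z hz
    have h3 := hF z
    rw [hgS z hz, mul_zero] at h3
    by_cases hu : UniqueDiffWithinAt ℝ S z
    · rw [h3.hasFDerivAt.hasFDerivWithinAt.fderivWithin hu]
      ext; simp
    · exact fderivWithin_zero_of_not_uniqueDiffWithinAt hu
  have hgl : ∀ x ∈ Iic β, g x = 0 := h1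
  have hgr : ∀ x ∈ Ici M, g x = 0 := h2
  have P1 : ∀ x ≤ β, P x = P β := fun x hx => dconst dP (convex_Iic β) hgl x hx β self_mem_Iic
  have P2 : ∀ x, M ≤ x → P x = P M := fun x hx => dconst dP (convex_Ici M) hgr x hx M self_mem_Ici
  have Q1 : ∀ x ≤ β, Q x = Q β := fun x hx => dconst dQ (convex_Iic β) hgl x hx β self_mem_Iic
  have Q2 : ∀ x, M ≤ x → Q x = Q M := fun x hx => dconst dQ (convex_Ici M) hgr x hx M self_mem_Ici
  have PM : P M = 0 := intervalIntegral.integral_same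
  have Qβ : Q β = 0 := intervalIntegral.integral_same
  obtain ⟨CP, hCP0, hCP⟩ := exists_norm_le_of_eventually_const cP.continuous P1 P2
  obtain ⟨CQ, hCQ0, hCQ⟩ := exists_norm_le_of_eventually_const cQ.continuous Q1 Q2
  have bP : ∀ x : ℝ, ‖exp (κ * x) * P x‖ ≤ Real.exp (κ.re * |M|) * CP := by
    intro x
    rcases le_total M x with hx | hx
    · rw [P2 x hx, PM, mul_zero, norm_zero]; positivity
    · rw [norm_mul, norm_exp]
      have : (κ * x).re = κ.re * x := by simp
      rw [this]
      gcongr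
      · exact hx.trans (le_abs_self M)
      · exact hCP x
  have bQ : ∀ x : ℝ, ‖exp (-κ * x) * Q x‖ ≤ 1 * CQ := by
    intro x
    rcases le_total x β with hx | hx
    · rw [Q1 x hx, Qβ, mul_zero, norm_zero]; positivity
    · rw [norm_mul, norm_exp]
      have : (-κ * x).re = -(κ.re * x) := by simp
      rw [this]
      gcongr
      · have := mul_nonneg hre (hβ.trans hx)
        rw [Real.exp_le_one_iff]; linarith
      · exact hCQ x
  have hE : ∀ x : ℝ, exp (κ * x) * exp (-κ * x) = 1 := fun x => by
    rw [← exp_add]; simp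
  have dEP := fun x => (hasDerivAt_exp_const_mul κ x).mul (dP x)
  have dEQ := fun x => (hasDerivAt_exp_const_mul (-κ) x).mul (dQ x)
  refine ⟨fun x => (2 * κ)⁻¹ * (exp (κ * x) * P x - exp (-κ * x) * Q x),
    fun x => 2⁻¹ * (exp (κ * x) * P x + exp (-κ * x) * Q x), (2 * κ)⁻¹ * P β, ?_, ?_, ?_, ?_, ?_, ?_⟩
  · exact contDiff_const.mul (((contDiff_exp_const_mul κ).mul cP).sub
      ((contDiff_exp_const_mul (-κ)).mul cQ))
  · intro x
    refine (((dEP x).sub (dEQ x)).const_mul ((2 * κ)⁻¹)).congr_deriv ?_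
    field_simp
    ring
  · intro x
    refine (((dEP x).add (dEQ x)).const_mul ((2 : ℂ)⁻¹)).congr_deriv ?_
    have h3 := hE x
    dsimp only
    generalize exp (κ * x) = e₁ at h3 ⊢
    generalize exp (-κ * x) = e₂ at h3 ⊢
    field_simp
    linear_combination (2 * g x) * h3
  · refine ⟨‖(2 * κ)⁻¹‖ * (Real.exp (κ.re * |M|) * CP + 1 * CQ), fun x => ?_⟩
    rw [norm_mul]
    gcongr
    exact (norm_sub_le _ _).trans (add_le_add (bP x) (bQ x))
  · refine ⟨‖(2 : ℂ)⁻¹‖ * (Real.exp (κ.re * |M|) * CP + 1 * CQ), fun x => ?_⟩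
    rw [norm_mul]
    gcongr
    exact (norm_add_le _ _).trans (add_le_add (bP x) (bQ x))
  · intro x hx
    simp only [P1 x hx, Q1 x hx, Qβ]
    constructor
    · ring
    · field_simp
      ring

theorem hasBoundedC2_exp (ξ : ℝ) : HasBoundedC2 (fun x : ℝ => exp (I * ξ * x)) := by
  have hn : ∀ x : ℝ, ‖exp (I * ξ * x)‖ = 1 := fun x => by
    rw [show I * ξ * x = ((ξ * x : ℝ) : ℂ) * I by push_cast; ring, norm_exp_ofReal_mul_I]
  refine HasBoundedC2.of_hasDerivAt (contDiff_exp_const_mul _)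
    (fun x => hasDerivAt_exp_const_mul _ x)
    (fun x => (hasDerivAt_exp_const_mul _ x).const_mul _)
    ⟨1, fun x => (hn x).le⟩ ⟨‖I * ξ‖, fun x => ?_⟩ ⟨‖I * ξ‖ * ‖I * ξ‖, fun x => ?_⟩
  · rw [norm_mul _ (exp _), hn, mul_one]
  · rw [norm_mul, norm_mul (I * ξ) (exp _), hn, mul_one]

end ODE

/-! ### Testing with cut-off waves; the flux and its analytic continuation. -/

section Flux

open Complex SectorCutoff

variable {E : Type*} [NormedAddCommGroup E] [InnerProductSpace ℝ E]
    [FiniteDimensional ℝ E] [MeasurableSpace E] [BorelSpace E]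

/-- The test function is `fn · e^{iξa} f(b)`. By the Leibniz rule the derivatives of the cutoff give
the commutator, and the last summand is the cutoff times what the Helmholtz operator leaves of the
wave. -/
theorem integral_cutoff_wave {k ε : ℝ} {U : Set E} {w : E → ℂ}
    (hsol : IsWeakHelmholtzSolution k U w) (hw : IntegrableOn w U)
    {τ ν : E} (hτ : ‖τ‖ = 1) (hν : ‖ν‖ = 1) (hτν : inner ℝ τ ν = 0)
    (hU : ∀ p : E, 1 ≤ inner ℝ ν p / ε + |inner ℝ τ p| → p ∈ U) (ξ : ℝ) {f f' f'' : ℝ → ℂ}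
    (hf : ContDiff ℝ ∞ f) (h1 : ∀ x, HasDerivAt f (f' x) x) (h2 : ∀ x, HasDerivAt f' (f'' x) x)
    (b0 : ∃ C, ∀ x, ‖f x‖ ≤ C) (b1 : ∃ C, ∀ x, ‖f' x‖ ≤ C) (b2 : ∃ C, ∀ x, ‖f'' x‖ ≤ C) :
    ∫ p in U, exp (I * ξ * (inner ℝ τ p : ℝ)) *
      (f (inner ℝ ν p) * (daa ε (inner ℝ τ p) (inner ℝ ν p) + dbb ε (inner ℝ τ p) (inner ℝ ν p))
        + 2 * I * ξ * f (inner ℝ ν p) * da ε (inner ℝ τ p) (inner ℝ ν p)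
        + 2 * f' (inner ℝ ν p) * db ε (inner ℝ τ p) (inner ℝ ν p)
        + fn ε (inner ℝ τ p) (inner ℝ ν p)
          * (f'' (inner ℝ ν p) + (k ^ 2 - ξ ^ 2) * f (inner ℝ ν p))) * w p = 0 := by
  set Φ : ℝ → ℝ → ℂ := fun a b => fn ε a b * (exp (I * ξ * a) * f b) with hΦ
  have hφ : HasBoundedC2 (fun p : E => Φ (inner ℝ τ p) (inner ℝ ν p)) :=
    (hasBoundedC2_fn τ ν).mul (((hasBoundedC2_exp ξ).comp_clm (innerSL ℝ τ)).mul
      ((HasBoundedC2.of_hasDerivAt hf h1 h2 b0 b1 b2).comp_clm (innerSL ℝ ν)))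
  have hsupp : tsupport (fun p : E => Φ (inner ℝ τ p) (inner ℝ ν p)) ⊆ U := by
    have hcl : IsClosed {p : E | 1 ≤ inner ℝ ν p / ε + |inner ℝ τ p|} :=
      isClosed_le continuous_const (by fun_prop)
    refine (closure_minimal ?_ hcl).trans hU
    intro p hp
    by_contra hlt
    have : inner ℝ ν p / ε + |inner ℝ τ p| ≤ 1 := (not_le.mp hlt).le
    exact hp (by simp only [hΦ]; rw [fn_eq_zero this, zero_mul])
  have hd := fun a : ℝ => hasDerivAt_exp_const_mul (I * ξ) a
  have key := hsol.integral_bounded hw hφ hsupp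
  rw [← key]
  congr 1 with p
  rw [laplacian_planar hτ hν hτν (Φ := Φ)
    (fun a b => (hasDerivAt_fn_a ε a b).mul ((hd a).mul_const (f b)))
    (fun a b => ((hasDerivAt_da_a ε a b).mul ((hd a).mul_const (f b))).add
      ((hasDerivAt_fn_a ε a b).mul (((hd a).const_mul (I * ξ)).mul_const (f b))))
    (fun a b => (hasDerivAt_fn_b ε a b).mul ((h1 b).const_mul (exp (I * ξ * a))))
    (fun a b => ((hasDerivAt_db_b ε a b).mul ((h1 b).const_mul (exp (I * ξ * a)))).add
      ((hasDerivAt_fn_b ε a b).mul ((h2 b).const_mul (exp (I * ξ * a)))))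
    (hφ.contDiff.of_le two_le_infty)]
  simp only [hΦ]
  linear_combination (exp (I * ξ * (inner ℝ τ p : ℝ)) * fn ε (inner ℝ τ p) (inner ℝ ν p)
    * f (inner ℝ ν p) * ξ ^ 2 * w p) * -I_sq

/-- The commutator of the Helmholtz operator with the cutoff, applied to the plane wave with
wave vector `k (cos z, sin z)`. -/
noncomputable def fluxKernel (k ε : ℝ) (z : ℂ) (a b : ℝ) : ℂ :=
  exp (I * (k * (a * cos z + b * sin z))) *
    (2 * I * k * (cos z * da ε a b + sin z * db ε a b) + daa ε a b + dbb ε a b)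

theorem re_phase (k a b : ℝ) (z : ℂ) : (I * (k * (a * cos z + b * sin z))).re
    = k * -Real.sinh z.im * (b * Real.cos z.re - a * Real.sin z.re) := by
  have h1 : (cos z).im = -(Real.sin z.re * Real.sinh z.im) := by
    rw [cos_eq z]
    simp [← ofReal_cos, ← ofReal_sin, ← ofReal_sinh, ← ofReal_cosh]
  have h2 : (sin z).im = Real.cos z.re * Real.sinh z.im := by
    rw [sin_eq z]
    simp [← ofReal_cos, ← ofReal_sin, ← ofReal_sinh, ← ofReal_cosh]
  simp [h1, h2]
  ring

/-- At non-real angles only the support of the cutoff's derivatives matters. There `b ≤ ε (2 -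
|a|)`, and the condition on `z.re` makes the loss `-ε |a| cos` absorb the term `-a sin` of the
growth rate. -/
theorem exists_norm_fluxKernel_le {k ε : ℝ} (hk : 0 < k) (hε : 0 < ε) :
    ∃ M : ℂ → ℝ, Continuous M ∧ ∀ z : ℂ, (z.im = 0 ∨
      z.im ≤ 0 ∧ |Real.sin z.re| ≤ ε * Real.cos z.re) → ∀ a b, ‖fluxKernel k ε z a b‖ ≤ M z := by
  obtain ⟨C, hC0, hC⟩ := exists_norm_deriv_le ε
  refine ⟨fun z => Real.exp (k * -Real.sinh z.im * (2 * ε)) *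
    (2 * k * (‖cos z‖ * C + ‖sin z‖ * C) + C + C), by fun_prop, fun z hz a b => ?_⟩
  rcases lt_or_ge 2 (b / ε + |a|) with hab | hab
  · obtain ⟨e1, e2, e3, e4⟩ := deriv_eq_zero hab
    simp only [fluxKernel, e1, e2, e3, e4, mul_zero, add_zero, norm_zero]
    positivity
  obtain ⟨c1, c2, c3, c4⟩ := hC a b
  rw [fluxKernel, norm_mul, norm_exp]
  have hexp : (I * (k * (a * cos z + b * sin z))).re ≤ k * -Real.sinh z.im * (2 * ε) := by
    rw [re_phase]
    rcases hz with hz | ⟨hz, hs⟩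
    · simp [hz]
    have hq : 0 ≤ -Real.sinh z.im := by
      rw [← Real.sinh_neg]; exact Real.sinh_nonneg_iff.mpr (by linarith)
    refine mul_le_mul_of_nonneg_left ?_ (by positivity)
    have hb : b ≤ ε * (2 - |a|) := by
      rw [← div_le_iff₀' hε]; linarith
    have hcos : 0 ≤ Real.cos z.re := by
      by_contra hneg
      have : ε * Real.cos z.re < 0 := mul_neg_of_pos_of_neg hε (not_le.mp hneg)
      linarith [abs_nonneg (Real.sin z.re)]
    have hcos1 := Real.cos_le_one z.re
    have h1 : -(a * Real.sin z.re) ≤ |a| * (ε * Real.cos z.re) := by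
      refine (neg_le_abs _).trans ?_
      rw [abs_mul]
      exact mul_le_mul_of_nonneg_left hs (abs_nonneg a)
    have h2 := mul_le_mul_of_nonneg_right hb hcos
    have h3 := mul_le_mul_of_nonneg_left hcos1 hε.le
    nlinarith
  refine mul_le_mul (Real.exp_le_exp.mpr hexp) ?_ (norm_nonneg _) (Real.exp_pos _).le
  refine (norm_add_le _ _).trans (add_le_add ((norm_add_le _ _).trans (add_le_add ?_ c3)) c4)
  rw [norm_mul]
  have : ‖2 * I * (k : ℂ)‖ = 2 * k := by simp [abs_of_pos hk]
  rw [this]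
  gcongr
  refine (norm_add_le _ _).trans (add_le_add ?_ ?_)
  · rw [norm_mul]; gcongr
  · rw [norm_mul]; gcongr

theorem continuous_fluxKernel {F : Type*} [NormedAddCommGroup F] [InnerProductSpace ℝ F]
    (k ε : ℝ) (z : ℂ) (τ ν : F) :
    Continuous (fun p : F => fluxKernel k ε z (inner ℝ τ p) (inner ℝ ν p)) := by
  obtain ⟨h1, h2, h3, h4⟩ := continuous_deriv ε
  have hi : Continuous fun p : F => ((inner ℝ τ p : ℝ), (inner ℝ ν p : ℝ)) := by fun_prop
  have h1' := h1.comp hi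
  have h2' := h2.comp hi
  have h3' := h3.comp hi
  have h4' := h4.comp hi
  simp only [Function.comp_def] at h1' h2' h3' h4'
  unfold fluxKernel
  fun_prop

theorem differentiable_fluxKernel (k ε a b : ℝ) :
    Differentiable ℂ (fun z => fluxKernel k ε z a b) := by
  unfold fluxKernel
  fun_prop

theorem integrable_fluxKernel {k ε : ℝ} (hk : 0 < k) (hε : 0 < ε) {U : Set E} {w : E → ℂ}
    (hw : IntegrableOn w U) (τ ν : E) {z : ℂ}
    (hz : z.im = 0 ∨ z.im ≤ 0 ∧ |Real.sin z.re| ≤ ε * Real.cos z.re) :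
    IntegrableOn (fun p => fluxKernel k ε z (inner ℝ τ p) (inner ℝ ν p) * w p) U := by
  obtain ⟨M, -, hM⟩ := exists_norm_fluxKernel_le hk hε
  exact hw.bdd_mul (c := M z) (continuous_fluxKernel k ε z τ ν).aestronglyMeasurable
    (.of_forall fun p => hM z hz _ _)

/-- For a real angle the plane wave is bounded and solves the equation exactly, so only the
commutator survives. -/
theorem integral_fluxKernel_ofReal {k ε : ℝ} {U : Set E} {w : E → ℂ}
    (hsol : IsWeakHelmholtzSolution k U w) (hw : IntegrableOn w U)
    {τ ν : E} (hτ : ‖τ‖ = 1) (hν : ‖ν‖ = 1) (hτν : inner ℝ τ ν = 0)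
    (hU : ∀ p : E, 1 ≤ inner ℝ ν p / ε + |inner ℝ τ p| → p ∈ U) (s : ℝ) :
    ∫ p in U, fluxKernel k ε s (inner ℝ τ p) (inner ℝ ν p) * w p = 0 := by
  set η : ℝ := k * Real.sin s
  have hn : ∀ x : ℝ, ‖exp (I * η * x)‖ = 1 := fun x => by
    rw [show I * η * x = ((η * x : ℝ) : ℂ) * I by push_cast; ring, norm_exp_ofReal_mul_I]
  have key := integral_cutoff_wave hsol hw hτ hν hτν hU (k * Real.cos s)
    (contDiff_exp_const_mul (I * η)) (hasDerivAt_exp_const_mul (I * η))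
    (fun x => (hasDerivAt_exp_const_mul (I * η) x).const_mul _)
    ⟨1, fun x => (hn x).le⟩ ⟨‖I * η‖, fun x => by rw [norm_mul _ (exp _), hn, mul_one]⟩
    ⟨‖I * η‖ * ‖I * η‖, fun x => by
      rw [norm_mul, norm_mul (I * η) (exp _), hn, mul_one]⟩
  rw [← key]
  congr 1 with p
  have hexp : exp (I * (k * ((inner ℝ τ p : ℝ) * cos s + (inner ℝ ν p : ℝ) * sin s)))
      = exp (I * (k * Real.cos s : ℝ) * (inner ℝ τ p : ℝ)) * exp (I * η * (inner ℝ ν p : ℝ)) := by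
    rw [← exp_add]
    congr 1
    simp only [η]
    push_cast
    ring
  rw [fluxKernel, hexp]
  simp only [η]
  push_cast
  have hsc := sin_sq_add_cos_sq (s : ℂ)
  have hI := I_sq
  set e1 := exp (I * (↑k * cos ↑s) * ↑(inner ℝ τ p : ℝ))
  set e2 := exp (I * (↑k * sin ↑s) * ↑(inner ℝ ν p : ℝ))
  linear_combination (e1 * e2 * fn ε (inner ℝ τ p) (inner ℝ ν p) * k ^ 2 * w p) * hsc
    - (e1 * e2 * fn ε (inner ℝ τ p) (inner ℝ ν p) * k ^ 2 * sin s ^ 2 * w p) * hI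

/-- The wave itself is unbounded here and cannot be tested with; the flux is continued analytically
from real angles. -/
theorem integral_fluxKernel_neg_imaginary {k ε : ℝ} (hk : 0 < k) (hε : 0 < ε) {U : Set E}
    {w : E → ℂ} (hsol : IsWeakHelmholtzSolution k U w) (hw : IntegrableOn w U)
    {τ ν : E} (hτ : ‖τ‖ = 1) (hν : ‖ν‖ = 1) (hτν : inner ℝ τ ν = 0)
    (hU : ∀ p : E, 1 ≤ inner ℝ ν p / ε + |inner ℝ τ p| → p ∈ U) {t : ℝ} (ht : 0 < t) :
    ∫ p in U, fluxKernel k ε (-(t * I)) (inner ℝ τ p) (inner ℝ ν p) * w p = 0 := by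
  obtain ⟨M, hMc, hM⟩ := exists_norm_fluxKernel_le hk hε
  -- For `|x| < d`, `|sin x| < ε / 2` and `cos x > 1 / 2`.
  set d : ℝ := min 1 (ε / 2)
  have hd : 0 < d := by positivity
  have hsec : ∀ x ∈ Ioo (-d) d, |Real.sin x| ≤ ε * Real.cos x := by
    intro x hx
    have h1 : |x| < d := abs_lt.mpr hx
    have h2 : |x| < 1 := h1.trans_le (min_le_left _ _)
    have h3 : |x| < ε / 2 := h1.trans_le (min_le_right _ _)
    have h4 := Real.one_sub_sq_div_two_le_cos (x := x)
    have h5 : x ^ 2 < 1 := (sq_lt_one_iff_abs_lt_one x).mpr h2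
    have h6 : |Real.sin x| ≤ |x| := Real.abs_sin_le_abs
    nlinarith
  have hbound : ∀ z ∈ Ioo (-d) d ×ℂ Iic 0, ∀ p : E,
      ‖fluxKernel k ε z (inner ℝ τ p) (inner ℝ ν p) * w p‖ ≤ M z * ‖w p‖ := by
    intro z hz p
    rw [norm_mul]
    gcongr
    exact hM z (.inr ⟨hz.2, hsec _ hz.1⟩) _ _
  have hmeas : ∀ z : ℂ, AEStronglyMeasurable
      (fun p => fluxKernel k ε z (inner ℝ τ p) (inner ℝ ν p) * w p) (volume.restrict U) :=
    fun z => (continuous_fluxKernel k ε z τ ν).aestronglyMeasurable.mul hw.1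
  have hMn : ∀ z₀ : ℂ, ∀ᶠ z in nhds z₀, M z ≤ M z₀ + 1 := fun z₀ =>
    (hMc.tendsto z₀).eventually_le_const (lt_add_one _)
  have hopen : IsOpen (Ioo (-d) d ×ℂ Iio 0) := isOpen_Ioo.reProdIm isOpen_Iio
  have hsub : Ioo (-d) d ×ℂ Iio 0 ⊆ Ioo (-d) d ×ℂ Iic 0 := fun z hz => ⟨hz.1, show z.im ≤ 0 from le_of_lt hz.2⟩
  refine eq_zero_of_eq_zero_on_real_segment
    (f := fun z => ∫ p in U, fluxKernel k ε z (inner ℝ τ p) (inner ℝ ν p) * w p) hd ?_ ?_ ?_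
    (x := -(t * I)) ?_
  · refine differentiableOn_integral_of_dominated hopen (fun z _ => hmeas z)
      (fun p => ((differentiable_fluxKernel k ε _ _).mul_const _).differentiableOn)
      fun z₀ hz₀ => ⟨fun p => (M z₀ + 1) * ‖w p‖, hw.norm.const_mul _, ?_⟩
    filter_upwards [hMn z₀, hopen.mem_nhds hz₀] with z hz hzS p
    exact (hbound z (hsub hzS) p).trans (by gcongr)
  · intro z₀ hz₀
    refine continuousWithinAt_of_dominated (bound := fun p => (M z₀ + 1) * ‖w p‖)
      (.of_forall hmeas) ?_ (hw.norm.const_mul _) ?_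
    · filter_upwards [(hMn z₀).filter_mono nhdsWithin_le_nhds, self_mem_nhdsWithin] with z hz hzS
      exact .of_forall fun p => (hbound z hzS p).trans (by gcongr)
    · exact .of_forall fun p =>
        ((differentiable_fluxKernel k ε _ _).continuous.mul continuous_const).continuousWithinAt
  · exact fun x _ => integral_fluxKernel_ofReal hsol hw hτ hν hτν hU x
  · refine ⟨?_, ?_⟩
    · simpa using hd
    · simpa using ht

/-- For `ξ < k` the angle is `arccos (ξ / k)`; for `ξ > k` it is `-it` with `cosh t = ξ / k`, the
sign giving `κ = k sinh t > 0`. At `ξ = k` one would have `κ = 0`. -/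
theorem exists_angle_of_frequency {k ε ξ : ℝ} (hk : 0 < k) (hε : 0 < ε) (hξ : 0 ≤ ξ) (hne : ξ ≠ k)
    {U : Set E} {w : E → ℂ} (hsol : IsWeakHelmholtzSolution k U w) (hw : IntegrableOn w U)
    {τ ν : E} (hτ : ‖τ‖ = 1) (hν : ‖ν‖ = 1) (hτν : inner ℝ τ ν = 0)
    (hU : ∀ p : E, 1 ≤ inner ℝ ν p / ε + |inner ℝ τ p| → p ∈ U) :
    ∃ z : ℂ, k * cos z = ξ ∧ I * (k * sin z) ≠ 0 ∧ 0 ≤ (I * (k * sin z)).re ∧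
      IntegrableOn (fun p => fluxKernel k ε z (inner ℝ τ p) (inner ℝ ν p) * w p) U ∧
      ∫ p in U, fluxKernel k ε z (inner ℝ τ p) (inner ℝ ν p) * w p = 0 := by
  rcases hne.lt_or_gt with h | h
  · have h1 : ξ / k < 1 := (div_lt_one hk).mpr h
    have h0 : 0 ≤ ξ / k := by positivity
    refine ⟨(Real.arccos (ξ / k) : ℝ), ?_, ?_, ?_,
      integrable_fluxKernel hk hε hw τ ν (.inl (ofReal_im _)),
      integral_fluxKernel_ofReal hsol hw hτ hν hτν hU _⟩
    · rw [← ofReal_cos, Real.cos_arccos (by linarith) h1.le]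
      push_cast
      exact mul_div_cancel₀ _ (ofReal_ne_zero.mpr hk.ne')
    · rw [← ofReal_sin, Real.sin_arccos]
      have : Real.sqrt (1 - (ξ / k) ^ 2) ≠ 0 := (Real.sqrt_pos.mpr (by nlinarith)).ne'
      simp only [ne_eq, mul_eq_zero, I_ne_zero, ofReal_eq_zero, hk.ne', this, or_self,
        not_false_iff]
    · rw [← ofReal_sin, ← ofReal_mul]
      simp
  · have h1 : 1 < ξ / k := (one_lt_div hk).mpr h
    set t := Real.arsinh (Real.sqrt ((ξ / k) ^ 2 - 1)) with ht
    have hs : 0 < Real.sqrt ((ξ / k) ^ 2 - 1) := Real.sqrt_pos.mpr (by nlinarith)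
    have htpos : 0 < t := Real.arsinh_pos_iff.mpr hs
    have hsinh : Real.sinh t = Real.sqrt ((ξ / k) ^ 2 - 1) := Real.sinh_arsinh _
    have hcosh : Real.cosh t = ξ / k := by
      rw [ht, Real.cosh_arsinh, Real.sq_sqrt (by nlinarith)]
      rw [show 1 + ((ξ / k) ^ 2 - 1) = (ξ / k) ^ 2 by ring]
      exact Real.sqrt_sq (by linarith)
    have hsin : I * (k * sin (-(t * I))) = ((k * Real.sinh t : ℝ) : ℂ) := by
      rw [sin_neg, sin_mul_I]
      push_cast
      linear_combination (-(k : ℂ) * sinh t) * I_sq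
    refine ⟨-(t * I), ?_, ?_, ?_, integrable_fluxKernel hk hε hw τ ν (.inr ⟨?_, ?_⟩),
      integral_fluxKernel_neg_imaginary hk hε hsol hw hτ hν hτν hU htpos⟩
    · rw [cos_neg, cos_mul_I, ← ofReal_cosh, hcosh]
      push_cast
      exact mul_div_cancel₀ _ (ofReal_ne_zero.mpr hk.ne')
    · rw [hsin, hsinh]
      exact_mod_cast (mul_pos hk hs).ne'
    · rw [hsin, ofReal_re, hsinh]
      positivity
    · simpa using htpos.le
    · simpa using hε.le

/-- The transverse Fourier transform of a solution vanishes at every frequency `ξ ≠ k`. -/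
theorem integral_wave_mul_eq_zero {k ε ξ : ℝ} (hk : 0 < k) (hε : 0 < ε) (hξ : 0 ≤ ξ) (hne : ξ ≠ k)
    {U : Set E} {w : E → ℂ} (hsol : IsWeakHelmholtzSolution k U w) (hw : IntegrableOn w U)
    {τ ν : E} (hτ : ‖τ‖ = 1) (hν : ‖ν‖ = 1) (hτν : inner ℝ τ ν = 0)
    (hU : ∀ p : E, 1 ≤ inner ℝ ν p / ε + |inner ℝ τ p| → p ∈ U)
    {g : ℝ → ℂ} (hg : ContDiff ℝ ∞ g) {M : ℝ} (h1 : ∀ x ≤ 2 * ε, g x = 0)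
    (h2 : ∀ x, M ≤ x → g x = 0) :
    ∫ p in U, exp (I * ξ * (inner ℝ τ p : ℝ)) * g (inner ℝ ν p) * w p = 0 := by
  obtain ⟨z, hcos, hκ, hre, hint, hzero⟩ := exists_angle_of_frequency hk hε hξ hne hsol hw hτ hν hτν hU
  set κ := I * (k * sin z) with hκdef
  obtain ⟨f, f', c, hf, d1, d2, b0, b1, hc⟩ :=
    exists_bounded_solution hκ hre hg (by positivity : 0 ≤ 2 * ε) h1 h2
  obtain ⟨Cg, -, hCg⟩ := exists_norm_le_of_eventually_const hg.continuous (β := 2 * ε) (M := M)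
    (fun x hx => by rw [h1 x hx, h1 _ le_rfl]) (fun x hx => by rw [h2 x hx, h2 _ le_rfl])
  have b2 : ∃ C, ∀ x, ‖κ ^ 2 * f x + g x‖ ≤ C := by
    obtain ⟨C, hC⟩ := b0
    refine ⟨‖κ ^ 2‖ * C + Cg, fun x => (norm_add_le _ _).trans (add_le_add ?_ (hCg x))⟩
    rw [norm_mul]
    gcongr
    exact hC x
  have key := integral_cutoff_wave hsol hw hτ hν hτν hU ξ hf d1 d2 b0 b1 b2
  have hκ2 : κ ^ 2 = ξ ^ 2 - k ^ 2 := by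
    rw [← hcos, hκdef]
    linear_combination (k ^ 2 * sin z ^ 2) * I_sq - k ^ 2 * sin_sq_add_cos_sq z
  have hint2 : IntegrableOn
      (fun p => exp (I * ξ * (inner ℝ τ p : ℝ)) * g (inner ℝ ν p) * w p) U := by
    have := hg.continuous
    refine hw.bdd_mul (c := Cg) (Continuous.aestronglyMeasurable (by fun_prop))
      (.of_forall fun p => ?_)
    rw [norm_mul, show I * ξ * (inner ℝ τ p : ℝ) = ((ξ * inner ℝ τ p : ℝ) : ℂ) * I by
      push_cast; ring, norm_exp_ofReal_mul_I, one_mul]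
    exact hCg _
  have hsplit : ∀ p : E, exp (I * ξ * (inner ℝ τ p : ℝ)) *
      (f (inner ℝ ν p) * (daa ε (inner ℝ τ p) (inner ℝ ν p) + dbb ε (inner ℝ τ p) (inner ℝ ν p))
        + 2 * I * ξ * f (inner ℝ ν p) * da ε (inner ℝ τ p) (inner ℝ ν p)
        + 2 * f' (inner ℝ ν p) * db ε (inner ℝ τ p) (inner ℝ ν p)
        + fn ε (inner ℝ τ p) (inner ℝ ν p) * (κ ^ 2 * f (inner ℝ ν p) + g (inner ℝ ν p)
          + (k ^ 2 - ξ ^ 2) * f (inner ℝ ν p))) * w p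
      = c * (fluxKernel k ε z (inner ℝ τ p) (inner ℝ ν p) * w p)
        + exp (I * ξ * (inner ℝ τ p : ℝ)) * g (inner ℝ ν p) * w p := by
    intro p
    have hexp : exp (I * (k * ((inner ℝ τ p : ℝ) * cos z + (inner ℝ ν p : ℝ) * sin z)))
        = exp (I * ξ * (inner ℝ τ p : ℝ)) * exp (κ * (inner ℝ ν p : ℝ)) := by
      rw [← exp_add]
      congr 1
      rw [← hcos, hκdef]
      ring
    rw [fluxKernel, hexp, hκ2]
    -- For `b ≤ 2ε` the source vanishes and `f = c e^{κb}`, which leaves the flux kernel. Above, the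
    -- cutoff is locally `1`, and only `g` remains.
    rcases le_or_gt (inner ℝ ν p) (2 * ε) with hb | hb
    · obtain ⟨e1, e2⟩ := hc _ hb
      rw [e1, e2, h1 _ hb, ← hcos, hκdef]
      ring
    · have hb' : 2 < inner ℝ ν p / ε + |inner ℝ τ p| := by
        have := (lt_div_iff₀ hε).mpr hb
        linarith [abs_nonneg (inner ℝ τ p)]
      obtain ⟨e1, e2, e3, e4⟩ := deriv_eq_zero hb'
      rw [e1, e2, e3, e4, fn_eq_one hb'.le]
      ring
  simp only [hsplit] at key
  rw [integral_add (hint.const_mul c) hint2, integral_const_mul, hzero, mul_zero, zero_add] at key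
  exact key

end Flux

/-! ### Injectivity of the Fourier transform on integrable functions. -/

section Fourier

open scoped FourierTransform

variable {E : Type*} [NormedAddCommGroup E] [InnerProductSpace ℝ E]
    [FiniteDimensional ℝ E] [MeasurableSpace E] [BorelSpace E]

/-- Each bump is the transform of a Schwartz function, and the transform can be moved onto `f` under
the integral. -/
theorem ae_eq_zero_of_fourier_eq_zero {f : E → ℂ} (hf : Integrable f) (h : ∀ y, 𝓕 f y = 0) :
    ∀ᵐ x, f x = 0 := by
  refine ae_eq_zero_of_integral_contDiff_smul_eq_zero hf.locallyIntegrable fun g hg hgc => ?_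
  have hg₁ : HasCompactSupport (Complex.ofRealCLM ∘ g) := hgc.comp_left rfl
  have hg₂ : ContDiff ℝ ∞ (Complex.ofRealCLM ∘ g) := Complex.ofRealCLM.contDiff.comp hg
  set ψ := hg₁.toSchwartzMap hg₂ with hψ
  have hflip := VectorFourier.integral_fourierIntegral_smul_eq_flip (L := innerₗ E)
    Real.continuous_fourierChar continuous_inner
    ((𝓕⁻ ψ : SchwartzMap E ℂ).integrable (μ := volume)) hf
  rw [flip_innerₗ] at hflip
  change ∫ y, 𝓕 (⇑(𝓕⁻ ψ : SchwartzMap E ℂ)) y • f y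
    = ∫ y, (𝓕⁻ ψ : SchwartzMap E ℂ) y • 𝓕 f y at hflip
  rw [← SchwartzMap.fourier_coe, FourierTransform.fourier_fourierInv_eq] at hflip
  simp only [h, smul_zero, integral_zero] at hflip
  rw [← hflip]
  congr 1

theorem continuous_fourier {f : E → ℂ} (hf : Integrable f) : Continuous (𝓕 f) :=
  VectorFourier.fourierIntegral_continuous Real.continuous_fourierChar continuous_inner hf

end Fourier

/-! ### Vanishing on slabs and half-spaces. -/

section HalfSpace

open Complex
open scoped FourierTransform

variable {E : Type*} [NormedAddCommGroup E] [InnerProductSpace ℝ E]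
    [FiniteDimensional ℝ E]

theorem exists_unit_orthogonal_decomposition (hE : 2 ≤ Module.finrank ℝ E) {ν : E} (hν : ‖ν‖ = 1)
    (v : E) : ∃ τ : E, ‖τ‖ = 1 ∧ inner ℝ τ ν = 0 ∧
      v = ‖v - (inner ℝ ν v : ℝ) • ν‖ • τ + (inner ℝ ν v : ℝ) • ν := by
  set u := v - (inner ℝ ν v : ℝ) • ν with hu
  have huν : inner ℝ u ν = 0 := by
    rw [hu, inner_sub_left, real_inner_smul_left, real_inner_self_eq_norm_sq, hν,
      real_inner_comm]
    ring
  have hv : v = u + (inner ℝ ν v : ℝ) • ν := by rw [hu]; abel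
  by_cases h0 : u = 0
  · obtain ⟨x, hx, hx0⟩ : ∃ x ∈ (Submodule.span ℝ {ν})ᗮ, x ≠ 0 := by
      refine (Submodule.ne_bot_iff _).mp fun hbot => ?_
      have h1 := (Submodule.span ℝ {ν}).finrank_add_finrank_orthogonal
      rw [hbot, finrank_bot] at h1
      have h2 := finrank_span_le_card (R := ℝ) ({ν} : Set E)
      simp at h2
      omega
    refine ⟨‖x‖⁻¹ • x, norm_smul_inv_norm hx0, ?_, ?_⟩
    · rw [real_inner_smul_left, real_inner_comm,
        Submodule.mem_orthogonal_singleton_iff_inner_right.mp hx, mul_zero]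
    · rw [h0, norm_zero, zero_smul]
      rw [h0] at hv
      exact hv
  · refine ⟨‖u‖⁻¹ • u, norm_smul_inv_norm h0, ?_, ?_⟩
    · rw [real_inner_smul_left, huν, mul_zero]
    · rwa [smul_inv_smul₀ (norm_ne_zero_iff.mpr h0)]

variable [MeasurableSpace E] [BorelSpace E]

theorem ae_eq_zero_of_slab (hE : 2 ≤ Module.finrank ℝ E) {k ε δ : ℝ} (hk : 0 < k) (hε : 0 < ε)
    (hεδ : ε ≤ δ) {U : Set E} (hUm : MeasurableSet U) {ν : E} (hν : ‖ν‖ = 1)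
    (hU : ∀ p : E, -δ * ‖p‖ < inner ℝ ν p → p ∈ U) {w : E → ℂ}
    (hsol : IsWeakHelmholtzSolution k U w) (hw : IntegrableOn w U) (M : ℝ) :
    ∀ᵐ p ∂(volume.restrict U), 2 * ε < inner ℝ ν p → inner ℝ ν p < M → w p = 0 := by
  set χ : ℝ → ℂ := fun b => SectorCutoff.step (b - 2 * ε) * SectorCutoff.step (M - b) with hχ
  have hχs : ContDiff ℝ ∞ χ :=
    (SectorCutoff.contDiff_step.comp (contDiff_id.sub contDiff_const)).mul
      (SectorCutoff.contDiff_step.comp (contDiff_const.sub contDiff_id))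
  have hχl : ∀ x ≤ 2 * ε, χ x = 0 := fun x hx => by
    simp [hχ, SectorCutoff.step_of_nonpos (x := x - 2 * ε) (by linarith)]
  have hχr : ∀ x, M ≤ x → χ x = 0 := fun x hx => by
    simp [hχ, SectorCutoff.step_of_nonpos (x := M - x) (by linarith)]
  have hχn : ∀ x, ‖χ x‖ ≤ 1 := fun x => by
    rw [norm_mul]
    exact mul_le_one₀ (SectorCutoff.norm_step_le _) (norm_nonneg _) (SectorCutoff.norm_step_le _)
  set F : E → ℂ := U.indicator fun p => χ (inner ℝ ν p) * w p with hF
  have hFi : Integrable F := by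
    rw [hF, integrable_indicator_iff hUm]
    have := hχs.continuous
    exact hw.bdd_mul (c := 1) (Continuous.aestronglyMeasurable (by fun_prop))
      (.of_forall fun p => hχn _)
  have hFourier : ∀ y : E, 𝓕 F y
      = ∫ p in U, exp (I * (inner ℝ ((-(2 * Real.pi)) • y) p : ℝ)) * (χ (inner ℝ ν p) * w p) := by
    intro y
    rw [Real.fourier_eq', ← integral_indicator hUm]
    congr 1 with p
    by_cases hp : p ∈ U
    · simp only [hF, indicator_of_mem hp, smul_eq_mul, real_inner_smul_left,
        real_inner_comm y p]
      congr 2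
      push_cast
      ring
    · simp [hF, indicator_of_notMem hp]
  set q : E → ℝ := fun y => ‖(-(2 * Real.pi)) • y - (inner ℝ ν ((-(2 * Real.pi)) • y) : ℝ) • ν‖ with hq
  have hoff : ∀ y, q y ≠ k → 𝓕 F y = 0 := by
    intro y hy
    obtain ⟨τ, hτ, hτν, hdec⟩ := exists_unit_orthogonal_decomposition hE hν ((-(2 * Real.pi)) • y)
    set l : ℝ := inner ℝ ν ((-(2 * Real.pi)) • y)
    -- The normal part `e^{ilb}` of the character is absorbed into the profile `g`; only the
    -- transverse frequency `q y` is constrained.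
    have key := integral_wave_mul_eq_zero hk hε (norm_nonneg _) hy hsol hw hτ hν hτν ?_
      (g := fun b => exp (I * l * b) * χ b) ((contDiff_exp_const_mul _).mul hχs) (M := M)
      (fun x hx => by simp only [hχl x hx, mul_zero]) (fun x hx => by simp only [hχr x hx, mul_zero])
    · rw [hFourier, ← key]
      congr 1 with p
      have : (inner ℝ ((-(2 * Real.pi)) • y) p : ℝ) = q y * inner ℝ τ p + l * inner ℝ ν p := by
        conv_lhs => rw [hdec]
        rw [inner_add_left, real_inner_smul_left, real_inner_smul_left]
      rw [this]
      have hexp : exp (I * ((q y * inner ℝ τ p + l * inner ℝ ν p : ℝ) : ℂ))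
          = exp (I * (q y : ℝ) * (inner ℝ τ p : ℝ)) * exp (I * l * (inner ℝ ν p : ℝ)) := by
        rw [← exp_add]
        congr 1
        push_cast
        ring
      rw [hexp]
      ring
    · intro p hp
      refine hU p ?_
      have h1 : |inner ℝ τ p| ≤ ‖p‖ := by simpa [hτ] using abs_real_inner_le_norm τ p
      have h2 : ε * (1 - |inner ℝ τ p|) ≤ inner ℝ ν p := by
        rw [← le_div_iff₀' hε]; linarith
      nlinarith [norm_nonneg p]
  have hall : ∀ y, 𝓕 F y = 0 := by
    intro y
    by_cases hy : q y = k
    · have ht : Filter.Tendsto (fun t : ℝ => 𝓕 F (t • y)) (nhdsWithin 1 (Ioi 1)) (nhds (𝓕 F y)) := by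
        have hc : Continuous fun t : ℝ => 𝓕 F (t • y) :=
          (continuous_fourier hFi).comp (by fun_prop)
        have := (hc.tendsto 1).mono_left (nhdsWithin_le_nhds (s := Ioi 1))
        rwa [one_smul] at this
      refine tendsto_nhds_unique ht (tendsto_const_nhds.congr' ?_)
      filter_upwards [self_mem_nhdsWithin] with t ht
      have ht1 : (1 : ℝ) < t := ht
      refine (hoff _ ?_).symm
      have : q (t • y) = t * q y := by
        simp only [hq]
        rw [smul_comm _ t y, real_inner_smul_right, mul_smul, ← smul_sub, norm_smul,
          Real.norm_of_nonneg (by linarith)]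
      rw [this, hy]
      nlinarith
    · exact hoff y hy
  have hzero := ae_eq_zero_of_fourier_eq_zero hFi hall
  rw [ae_restrict_iff' hUm]
  filter_upwards [hzero] with p hp hpU h1 h2
  simp only [hF, indicator_of_mem hpU, mul_eq_zero, hχ, SectorCutoff.step, ofReal_eq_zero] at hp
  have p1 := Real.smoothTransition.pos_of_pos (x := inner ℝ ν p - 2 * ε) (by linarith)
  have p2 := Real.smoothTransition.pos_of_pos (x := M - inner ℝ ν p) (by linarith)
  rcases hp with (hp | hp) | hp
  · exact absurd hp p1.ne'
  · exact absurd hp p2.ne'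
  · exact hp

/-- An integrable solution in a set containing the cone `⟪ν, p⟫ > -δ ‖p‖` vanishes on the
half-space `⟪ν, p⟫ > 0`. -/
theorem ae_eq_zero_of_halfSpace (hE : 2 ≤ Module.finrank ℝ E) {k δ : ℝ} (hk : 0 < k) (hδ : 0 < δ)
    {U : Set E} (hUm : MeasurableSet U) {ν : E} (hν : ‖ν‖ = 1)
    (hU : ∀ p : E, -δ * ‖p‖ < inner ℝ ν p → p ∈ U) {w : E → ℂ}
    (hsol : IsWeakHelmholtzSolution k U w) (hw : IntegrableOn w U) :
    ∀ᵐ p ∂(volume.restrict U), 0 < inner ℝ ν p → w p = 0 := by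
  have h : ∀ᵐ p ∂(volume.restrict U), ∀ n m : ℕ, 2 * (δ / (n + 1)) < inner ℝ ν p →
      inner ℝ ν p < (m : ℝ) → w p = 0 := by
    rw [ae_all_iff]; intro n
    rw [ae_all_iff]; intro m
    refine ae_eq_zero_of_slab hE hk (by positivity) ?_ hUm hν hU hsol hw m
    exact div_le_self hδ.le (by linarith [(n.cast_nonneg : (0 : ℝ) ≤ n)])
  filter_upwards [h] with p hp hb
  obtain ⟨n, hn⟩ := exists_nat_gt (2 * δ / inner ℝ ν p)
  obtain ⟨m, hm⟩ := exists_nat_gt (inner ℝ ν p)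
  refine hp n m ?_ hm
  rw [div_lt_iff₀ hb] at hn
  rw [← mul_div_assoc, div_lt_iff₀ (by positivity)]
  nlinarith

end HalfSpace

/-! ### Half-spaces covering the conical domain. -/

section Cone

theorem isOpen_conicalDomain (n : ℕ) (θ : ℝ) : IsOpen (conicalDomain n θ) :=
  isOpen_lt (by fun_prop) (by fun_prop)

/-- Each point of the conical domain lies in an open half-space with normal `ν` through the origin,
such that the domain contains a larger circular cone with axis `ν`. -/
theorem exists_halfSpace_of_mem_conicalDomain {n : ℕ} (hn : 2 ≤ n) {θ : ℝ}
    (hθ : θ ∈ Ioo 0 (Real.pi / 2)) {p : WithLp 2 (EuclideanSpace ℝ (Fin (n - 1)) × ℝ)}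
    (hp : p ∈ conicalDomain n θ) :
    ∃ (ν : WithLp 2 (EuclideanSpace ℝ (Fin (n - 1)) × ℝ)) (δ : ℝ), ‖ν‖ = 1 ∧ 0 < δ ∧
      0 < inner ℝ ν p ∧ ∀ q, -δ * ‖q‖ < inner ℝ ν q → q ∈ conicalDomain n θ := by
  obtain ⟨hθ0, hθ1⟩ := hθ
  have hcos : 0 < Real.cos θ := Real.cos_pos_of_mem_Ioo ⟨by linarith, hθ1⟩
  have hsin : 0 < Real.sin θ := Real.sin_pos_of_pos_of_lt_pi hθ0 (by linarith [Real.pi_pos])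
  have hmem : ∀ q : WithLp 2 (EuclideanSpace ℝ (Fin (n - 1)) × ℝ), q ∈ conicalDomain n θ ↔
      0 < q.snd * Real.cos θ + ‖q.fst‖ * Real.sin θ := by
    intro q
    change q.snd > -‖q.fst‖ * Real.tan θ ↔ _
    rw [Real.tan_eq_sin_div_cos, gt_iff_lt, ← mul_div_assoc, div_lt_iff₀ hcos]
    constructor <;> intro h <;> linarith
  obtain ⟨e, he, hep⟩ : ∃ e : EuclideanSpace ℝ (Fin (n - 1)), ‖e‖ = 1 ∧ inner ℝ e p.fst = ‖p.fst‖ := by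
    by_cases h0 : p.fst = 0
    · have : Nonempty (Fin (n - 1)) := ⟨⟨0, by omega⟩⟩
      obtain ⟨e, he⟩ := exists_norm_eq (EuclideanSpace ℝ (Fin (n - 1))) zero_le_one
      exact ⟨e, he, by simp [h0]⟩
    · refine ⟨‖p.fst‖⁻¹ • p.fst, norm_smul_inv_norm h0, ?_⟩
      rw [real_inner_smul_left, real_inner_self_eq_norm_sq]
      field_simp
  have hpos := (hmem p).mp hp
  -- Tilting the normal to an angle slightly below `θ` keeps `p` inside the half-space, and the gap
  -- `θ - θ'` is the aperture gained: `δ = sin (θ - θ')`.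
  obtain ⟨θ', hpθ', h0θ', hθ'θ⟩ : ∃ θ', 0 < p.snd * Real.cos θ' + ‖p.fst‖ * Real.sin θ' ∧
      0 < θ' ∧ θ' < θ := by
    have hc : Continuous fun t => p.snd * Real.cos t + ‖p.fst‖ * Real.sin t := by fun_prop
    have h1 : ∀ᶠ t in nhdsWithin θ (Iio θ), 0 < p.snd * Real.cos t + ‖p.fst‖ * Real.sin t :=
      ((hc.tendsto θ).eventually_const_lt hpos).filter_mono nhdsWithin_le_nhds
    have h2 : ∀ᶠ t in nhdsWithin θ (Iio θ), 0 < t :=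
      (eventually_gt_nhds hθ0).filter_mono nhdsWithin_le_nhds
    obtain ⟨t, ⟨ht1, ht2⟩, ht3⟩ := ((h1.and h2).and self_mem_nhdsWithin).exists
    exact ⟨t, ht1, ht2, ht3⟩
  have hsin' : 0 < Real.sin θ' := Real.sin_pos_of_pos_of_lt_pi h0θ' (by linarith [Real.pi_pos])
  have hinner : ∀ q : WithLp 2 (EuclideanSpace ℝ (Fin (n - 1)) × ℝ),
      inner ℝ (WithLp.toLp 2 (Real.sin θ' • e, Real.cos θ')) q
        = Real.sin θ' * inner ℝ e q.fst + q.snd * Real.cos θ' := by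
    intro q
    rw [WithLp.prod_inner_apply]
    simp [real_inner_smul_left]
  have hdiff : 0 < Real.sin (θ - θ') :=
    Real.sin_pos_of_pos_of_lt_pi (by linarith) (by linarith [Real.pi_pos])
  refine ⟨WithLp.toLp 2 (Real.sin θ' • e, Real.cos θ'), Real.sin (θ - θ'), ?_, hdiff, ?_, ?_⟩
  · rw [← sq_eq_sq₀ (norm_nonneg _) zero_le_one, WithLp.prod_norm_sq_eq_of_L2]
    simp [norm_smul, he, Real.sin_sq_add_cos_sq]
  · rw [hinner, hep]
    linarith
  · intro q hq
    rw [hmem]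
    by_contra! hneg
    rw [hinner] at hq
    have hx := norm_nonneg q.fst
    have hy : q.snd ≤ 0 := by
      by_contra! hy
      have := mul_pos hy hcos
      have := mul_nonneg hx hsin.le
      linarith
    have he' : inner ℝ e q.fst ≤ ‖q.fst‖ := by
      simpa [he] using real_inner_le_norm e q.fst
    -- Outside the domain `‖q.fst‖ sin θ ≤ -q.snd cos θ`. Hence `sin θ ⟪ν, q⟫ ≤ q.snd sin (θ - θ')`,
    -- and this bound then contradicts `hq`.
    have hnorm : Real.sin θ * ‖q‖ ≤ -q.snd := by
      refine abs_le_of_sq_le_sq' ?_ (by linarith) |>.2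
      rw [mul_pow, WithLp.prod_norm_sq_eq_of_L2, Real.norm_eq_abs, sq_abs]
      have h1 : (‖q.fst‖ * Real.sin θ) ^ 2 ≤ (-q.snd * Real.cos θ) ^ 2 :=
        pow_le_pow_left₀ (by positivity) (by linarith) 2
      have h2 := Real.sin_sq_add_cos_sq θ
      nlinarith
    have h1 : Real.sin θ' * inner ℝ e q.fst ≤ Real.sin θ' * ‖q.fst‖ :=
      mul_le_mul_of_nonneg_left he' hsin'.le
    have h2 : Real.sin θ' * (‖q.fst‖ * Real.sin θ) ≤ Real.sin θ' * (-q.snd * Real.cos θ) :=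
      mul_le_mul_of_nonneg_left (by linarith) hsin'.le
    have h3 := mul_le_mul_of_nonneg_left hnorm hdiff.le
    have h4 : Real.sin θ * (-Real.sin (θ - θ') * ‖q‖)
        < Real.sin θ * (Real.sin θ' * inner ℝ e q.fst + q.snd * Real.cos θ') :=
      mul_lt_mul_of_pos_left hq hsin
    have h5 := mul_le_mul_of_nonneg_left h1 hsin.le
    rw [Real.sin_sub] at h3 h4
    nlinarith

end Cone

theorem theoremF1 (n : ℕ) (hn : 2 ≤ n) (k : ℝ) (hk : 0 < k)
    (θ : ℝ) (hθ : θ ∈ Ioo 0 (Real.pi / 2))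
    (w : WithLp 2 (EuclideanSpace ℝ (Fin (n - 1)) × ℝ) → ℂ)
    (hw : IntegrableOn w (conicalDomain n θ) volume)
    (hsol : IsWeakHelmholtzSolution k (conicalDomain n θ) w) :
    ∀ᵐ p ∂(volume.restrict (conicalDomain n θ)), w p = 0 := by
  have hm := (isOpen_conicalDomain n θ).measurableSet
  have hdim : 2 ≤ Module.finrank ℝ (WithLp 2 (EuclideanSpace ℝ (Fin (n - 1)) × ℝ)) := by
    rw [(WithLp.linearEquiv 2 ℝ (EuclideanSpace ℝ (Fin (n - 1)) × ℝ)).finrank_eq]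
    simp
    omega
  rw [ae_restrict_iff' hm, ae_iff]
  -- The half-spaces depend on `p`; local nullity passes from this uncountable cover to the whole
  -- domain.
  refine measure_null_of_locally_null _ fun p hp => ?_
  simp only [mem_ofPred_eq, Classical.not_imp] at hp
  obtain ⟨ν, δ, hν, hδ, hpν, hcone⟩ := exists_halfSpace_of_mem_conicalDomain hn hθ hp.1
  have key := ae_eq_zero_of_halfSpace hdim hk hδ hm hν hcone hsol hw
  rw [ae_restrict_iff' hm, ae_iff] at key
  refine ⟨_, ?_, key⟩
  have hopen : IsOpen {q | 0 < inner ℝ ν q} := isOpen_lt continuous_const (by fun_prop)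
  filter_upwards [nhdsWithin_le_nhds (hopen.mem_nhds hpν), self_mem_nhdsWithin] with q hq1 hq2
  simp only [Classical.not_imp] at hq2 ⊢
  exact ⟨hq2.1, hq1, hq2.2⟩
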